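/- Let $\mu$ be a probability measure on $\mathbb{C}$ with mean $0$ and unit variance, $\int |z|^2\,d\mu(z)=1$, and let $\nu$ be a probability measure on $\mathbb{R}$ with mean $0$ and finite variance. For every $N\ge 1$ let $X_N$ be a random $N\times N$ Hermitian matrix, all $X_N$ being defined on one common probability space (with no assumption on the joint distribution of the $X_N$ for different $N$), such that the entries of $X_N$ on and above the diagonal are independent, those strictly above the diagonal have law $\mu$, and those on the diagonal have law $\nu$. Let $V_N=\frac{1}{\sqrt N}X_N$ be the normalized Wigner matrix, let $\alpha\ge 0$ and $\beta>0$, and let $\Sigma_N=\alpha I_N+\beta V_N$, with eigenvalues $\lambda_1(\Sigma_N)\le\dots\le\lambda_N(\Sigma_N)$ counted with multiplicity. Then, with probability $1$, for every $x\in\mathbb{R}$ the empirical spectral distribution function $$\mu_{\Sigma_N}(x)=\frac1N\sum_{i=1}^N 1_{\{\lambda_i(\Sigma_N)\le x\}}$$ converges, as $N\to\infty$, to $\int_{-\infty}^x f_{\alpha,\beta}(t)\,dt$, where $$f_{\alpha,\beta}(t)=\begin{cases}\dfrac{1}{2\pi\beta^2}\sqrt{4\beta^2-(t-\alpha)^2},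 & |t-\alpha|\le 2\beta,\\[1ex] 0, & \text{otherwise,}\end{cases}$$ is a probability density (the semicircle law with center $\alpha$ and radius $2\beta$). -/

import Mathlib

open MeasureTheory ProbabilityTheory Filter Topology

/-- `IsWignerMatrix P μ ν X`: on the probability space `(Ω, P)`, the random `N × N` matrix `X` is an
(unnormalized) Wigner matrix with off-diagonal law `μ` (on `ℂ`) and diagonal law `ν` (on `ℝ`).
It is Hermitian, its entries on and above the diagonal are independent, those strictly above the
diagonal are identically distributed with mean zero and unit variance, those on the diagonal are
identically distributed with mean zero and finite variance. Real symmetric Wigner matrices are the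
case in which `μ` is carried by the real line. -/
structure IsWignerMatrix {Ω : Type*} [MeasurableSpace Ω] (P : Measure Ω)
    (μ : Measure ℂ) (ν : Measure ℝ) {N : ℕ} (X : Ω → Matrix (Fin N) (Fin N) ℂ) : Prop where
  isHermitian : ∀ ω, (X ω).IsHermitian
  indep : iIndepFun
    (fun (p : {p : Fin N × Fin N // p.1 ≤ p.2}) (ω : Ω) => X ω p.1.1 p.1.2) P
  law_offDiag : ∀ i j : Fin N, i < j → HasLaw (fun ω => X ω i j) μ P
  law_diag : ∀ i : Fin N, HasLaw (fun ω => (X ω i i).re) ν P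
  memLp_offDiag : MemLp (fun z : ℂ => z) 2 μ
  mean_offDiag : ∫ z, z ∂μ = 0
  variance_offDiag : ∫ z, ‖z‖ ^ 2 ∂μ = 1
  memLp_diag : MemLp (fun x : ℝ => x) 2 ν
  mean_diag : ∫ x, x ∂ν = 0

/-- The empirical spectral distribution function of a Hermitian matrix: the proportion of
eigenvalues, counted with multiplicity, that are at most `x`. -/
noncomputable def esd {N : ℕ} {A : Matrix (Fin N) (Fin N) ℂ} (hA : A.IsHermitian) (x : ℝ) : ℝ :=
  (1 / (N : ℝ)) * ∑ i : Fin N, (if hA.eigenvalues i ≤ x then (1 : ℝ) else 0)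

/-- The Wigner matrix in its usual normalization `V_N = N ^ (-1/2) X`, with off-diagonal entries of
variance `1 / N`. -/
noncomputable def normalizedWigner {N : ℕ} (X : Matrix (Fin N) (Fin N) ℂ) :
    Matrix (Fin N) (Fin N) ℂ :=
  ((1 / Real.sqrt (N : ℝ) : ℝ) : ℂ) • X

/-- The matrix `α I_N + β V`. -/
noncomputable def shiftScale (α β : ℝ) {N : ℕ} (V : Matrix (Fin N) (Fin N) ℂ) :
    Matrix (Fin N) (Fin N) ℂ :=
  (α : ℂ) • (1 : Matrix (Fin N) (Fin N) ℂ) + (β : ℂ) • V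

theorem isHermitian_ofReal_smul {N : ℕ} {A : Matrix (Fin N) (Fin N) ℂ} (hA : A.IsHermitian)
    (c : ℝ) : ((c : ℂ) • A).IsHermitian := by
  unfold Matrix.IsHermitian
  rw [Matrix.conjTranspose_smul, hA.eq]
  simp

theorem isHermitian_shiftScale_normalizedWigner (α β : ℝ) {N : ℕ}
    {X : Matrix (Fin N) (Fin N) ℂ} (hX : X.IsHermitian) :
    (shiftScale α β (normalizedWigner X)).IsHermitian :=
  (isHermitian_ofReal_smul Matrix.isHermitian_one α).add
    (isHermitian_ofReal_smul (isHermitian_ofReal_smul hX _) β)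

/-- The density of the semicircle law with center `α` and radius `2β`. -/
noncomputable def semicircleDensity (α β : ℝ) (x : ℝ) : ℝ :=
  if |x - α| ≤ 2 * β then
    1 / (2 * Real.pi * β ^ 2) * Real.sqrt (4 * β ^ 2 - (x - α) ^ 2)
  else 0

/-- The semicircle law with center `α` and radius `2β`. -/
noncomputable def semicircleLaw (α β : ℝ) : Measure ℝ :=
  volume.withDensity (fun x => ENNReal.ofReal (semicircleDensity α β x))

/-!
The proof uses resolvents. For nonreal `z`, let `s_N(z)` be the normalized trace of `(V_N - z)⁻¹`,
that is, the integral of `1 / (t - z)` against the empirical spectral measure of `V_N`.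

*Concentration.* Changing one column of the upper triangular part of `X_N` perturbs `V_N` by a
Hermitian matrix of rank at most two, so it moves `s_N(z)` by `O(1 / N)`, whatever the size of the
entries (`norm_empiricalStieltjes_update_sub_le`). The columns are independent, and McDiarmid's
inequality (`measureReal_abs_sub_integral_ge_le`) makes the deviation probabilities of `s_N(z)` from
its mean summable in `N`. By Borel–Cantelli, `s_N(z) - E s_N(z) → 0` almost surely, irrespective of
the joint law of the matrices, and the variance of `s_N(z)` vanishes.

*Self-consistent equation.* Write `G = (V - z)⁻¹`. The trace of `V G = 1 + z G` is a sum of terms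
`V i j * G j i`. Expanding `G` to second order in the single entry `V i j`, which is centered and
independent of the other entries, gives `E[V i j * G j i] ≈ - E[G i i * G j j] / N`. The error is of
Lindeberg type, bounded through `E[|x|² min(κ |x| / √N, 1)]`, so second moments suffice. Summation
yields `E[1 + z s_N + s_N²] → 0` (`IsWignerMatrix.norm_integral_quadratic_le`). Since
`Im s_N * Im z ≥ 0`, only the root `m` of `m² + z m + 1 = 0` in the unit disc can be a limit
(`tendsto_of_tendsto_quadratic`), hence `s_N(z) → m` almost surely
(`ae_tendsto_empiricalStieltjes`).

*Identification of the limit.* The substitution `t = α + 2β cos θ` and Cauchy's formula on the unit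
circle show that the Stieltjes transform of the semicircle law is given by the same root
(`integral_semicircleLaw_inv_sub`).

*From transforms to distribution functions.* Almost surely, the transforms converge at all points
`i q` with `q ≠ 0` rational. The constants and the functions `1 / (t - i r)` span, up to uniform
closure, a star algebra that separates points; together with tightness, which is read off from the
transforms near `i ∞`, this gives weak convergence. As the semicircle law has no atoms, the
distribution functions converge at every point
(`tendsto_measureReal_Iic_of_tendsto_integral_resolvent`).
-/

open scoped BoundedContinuousFunction NNReal Matrix.Norms.L2Operator

/-! ### Stieltjes transforms on the imaginary axis and weak convergence -/

theorem ofReal_sub_mul_I_ne_zero {r : ℝ} (hr : r ≠ 0) (x : ℝ) : (x : ℂ) - r * Complex.I ≠ 0 := by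
  intro h
  apply hr
  simpa using congrArg Complex.im h

theorem abs_le_norm_ofReal_sub_mul_I (r x : ℝ) : |r| ≤ ‖(x : ℂ) - r * Complex.I‖ := by
  simpa using Complex.abs_im_le_norm ((x : ℂ) - r * Complex.I)

/-- The function `x ↦ 1 / (x - i r)`, as a bounded continuous function on the real line. -/
noncomputable def imagResolvent (r : ℝ) (hr : r ≠ 0) : ℝ →ᵇ ℂ :=
  BoundedContinuousFunction.ofNormedAddCommGroup (fun x : ℝ => ((x : ℂ) - r * Complex.I)⁻¹)
    (Continuous.inv₀ (by fun_prop) (ofReal_sub_mul_I_ne_zero hr)) |r|⁻¹ (fun x => by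
      rw [norm_inv]
      exact inv_anti₀ (abs_pos.mpr hr) (abs_le_norm_ofReal_sub_mul_I r x))

@[simp]
theorem imagResolvent_apply (r : ℝ) (hr : r ≠ 0) (x : ℝ) :
    imagResolvent r hr x = ((x : ℂ) - r * Complex.I)⁻¹ := rfl

theorem norm_imagResolvent_sub_le {r s : ℝ} (hr : r ≠ 0) (hs : s ≠ 0) :
    ‖imagResolvent r hr - imagResolvent s hs‖ ≤ |r - s| / (|r| * |s|) := by
  rw [BoundedContinuousFunction.norm_le (by positivity)]
  intro x
  have h1 := ofReal_sub_mul_I_ne_zero hr x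
  have h2 := ofReal_sub_mul_I_ne_zero hs x
  have : (imagResolvent r hr - imagResolvent s hs) x
      = ((r - s : ℝ) : ℂ) * Complex.I /
        (((x : ℂ) - r * Complex.I) * ((x : ℂ) - s * Complex.I)) := by
    simp only [BoundedContinuousFunction.coe_sub, Pi.sub_apply, imagResolvent_apply]
    rw [inv_sub_inv h1 h2]
    congr 1
    push_cast
    ring
  rw [this, norm_div, norm_mul, norm_mul, Complex.norm_I, mul_one, Complex.norm_real,
    Real.norm_eq_abs]
  have hr' := abs_pos.mpr hr
  have hs' := abs_pos.mpr hs
  gcongr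
  · exact abs_le_norm_ofReal_sub_mul_I r x
  · exact abs_le_norm_ofReal_sub_mul_I s x

theorem tendsto_imagResolvent {r : ℝ} (hr : r ≠ 0) {s : ℕ → ℝ} (hs : ∀ n, s n ≠ 0)
    (h : Tendsto s atTop (𝓝 r)) :
    Tendsto (fun n => imagResolvent (s n) (hs n)) atTop (𝓝 (imagResolvent r hr)) := by
  rw [tendsto_iff_norm_sub_tendsto_zero]
  refine squeeze_zero (fun _ => norm_nonneg _)
    (fun n => norm_imagResolvent_sub_le (hs n) hr) ?_
  have : Tendsto (fun n => |s n - r| / (|s n| * |r|)) atTop (𝓝 (|r - r| / (|r| * |r|))) := by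
    refine ((h.sub_const r).abs).div (h.abs.mul_const _) ?_
    have := abs_pos.mpr hr
    positivity
  simpa using this

theorem star_imagResolvent {r : ℝ} (hr : r ≠ 0) :
    star (imagResolvent r hr) = imagResolvent (-r) (neg_ne_zero.mpr hr) := by
  ext x
  simp

/-- The linear span of the constants and the functions `x ↦ 1 / (x - i r)`, `r ≠ 0`. -/
noncomputable def resolventSpan : Submodule ℂ (ℝ →ᵇ ℂ) :=
  Submodule.span ℂ (insert 1 (Set.range fun r : {r : ℝ // r ≠ 0} => imagResolvent r.1 r.2))

theorem imagResolvent_mem_resolventSpan {r : ℝ} (hr : r ≠ 0) :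
    imagResolvent r hr ∈ resolventSpan :=
  Submodule.subset_span (Or.inr ⟨⟨r, hr⟩, rfl⟩)

theorem imagResolvent_mul_mem_of_ne {r s : ℝ} (hr : r ≠ 0) (hs : s ≠ 0) (hrs : r ≠ s) :
    imagResolvent r hr * imagResolvent s hs ∈ resolventSpan := by
  have : imagResolvent r hr * imagResolvent s hs
      = (((r - s : ℝ) : ℂ) * Complex.I)⁻¹ • (imagResolvent r hr - imagResolvent s hs) := by
    ext x
    have h1 := ofReal_sub_mul_I_ne_zero hr x
    have h2 := ofReal_sub_mul_I_ne_zero hs x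
    have h3 : ((r - s : ℝ) : ℂ) ≠ 0 := by
      simpa [sub_eq_zero] using hrs
    simp only [BoundedContinuousFunction.coe_mul, Pi.mul_apply, imagResolvent_apply,
      BoundedContinuousFunction.coe_smul, BoundedContinuousFunction.coe_sub, Pi.sub_apply,
      smul_eq_mul]
    rw [inv_sub_inv h1 h2, show (x : ℂ) - s * Complex.I - (x - r * Complex.I)
      = ((r - s : ℝ) : ℂ) * Complex.I by push_cast; ring, ← mul_inv, inv_mul_eq_div,
      div_div_cancel_left' (mul_ne_zero h3 Complex.I_ne_zero)]
  rw [this]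
  exact resolventSpan.smul_mem _
    (resolventSpan.sub_mem (imagResolvent_mem_resolventSpan hr)
      (imagResolvent_mem_resolventSpan hs))

/-- Partial fractions handle distinct poles; the square of `1 / (x - i r)` is the uniform limit of
products with distinct poles. -/
theorem imagResolvent_mul_mem_closure {r s : ℝ} (hr : r ≠ 0) (hs : s ≠ 0) :
    imagResolvent r hr * imagResolvent s hs ∈ resolventSpan.topologicalClosure := by
  by_cases hrs : r = s
  · subst hrs
    have ht : ∀ n : ℕ, r * (1 + 1 / ((n : ℝ) + 1)) ≠ 0 := fun n => by positivity
    have hlim : Tendsto (fun n : ℕ => r * (1 + 1 / ((n : ℝ) + 1))) atTop (𝓝 r) := by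
      have := (tendsto_one_div_add_atTop_nhds_zero_nat (𝕜 := ℝ)).const_add 1 |>.const_mul r
      simpa using this
    refine mem_closure_of_tendsto
      ((tendsto_imagResolvent hr ht hlim).const_mul (imagResolvent r hr))
      (Eventually.of_forall fun n => imagResolvent_mul_mem_of_ne hr (ht n) ?_)
    intro h
    have h2 : (1 : ℝ) / ((n : ℝ) + 1) = 0 := by
      have : r * 1 = r * (1 + 1 / ((n : ℝ) + 1)) := by rw [mul_one]; exact h
      have := mul_left_cancel₀ hr this
      linarith
    have h3 : (1 : ℝ) / ((n : ℝ) + 1) ≠ 0 := by positivity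
    exact h3 h2
  · exact resolventSpan.le_topologicalClosure (imagResolvent_mul_mem_of_ne hr hs hrs)

theorem mul_mem_closure_resolventSpan {f g : ℝ →ᵇ ℂ} (hf : f ∈ resolventSpan)
    (hg : g ∈ resolventSpan) : f * g ∈ resolventSpan.topologicalClosure := by
  refine Submodule.span_induction₂
    (p := fun f g _ _ => f * g ∈ resolventSpan.topologicalClosure) ?_ ?_ ?_ ?_ ?_ ?_ ?_ hf hg
  · rintro f g (rfl | ⟨r, rfl⟩) hg
    · rw [one_mul]
      exact resolventSpan.le_topologicalClosure (Submodule.subset_span hg)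
    · rcases hg with rfl | ⟨s, rfl⟩
      · rw [mul_one]
        exact resolventSpan.le_topologicalClosure (imagResolvent_mem_resolventSpan r.2)
      · exact imagResolvent_mul_mem_closure r.2 s.2
  · intro g _; rw [zero_mul]; exact Submodule.zero_mem _
  · intro g _; rw [mul_zero]; exact Submodule.zero_mem _
  · intro a b c _ _ _ h1 h2; rw [add_mul]; exact Submodule.add_mem _ h1 h2
  · intro a b c _ _ _ h1 h2; rw [mul_add]; exact Submodule.add_mem _ h1 h2
  · intro c a b _ _ h; rw [smul_mul_assoc]; exact Submodule.smul_mem _ _ h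
  · intro c a b _ _ h; rw [mul_smul_comm]; exact Submodule.smul_mem _ _ h

theorem star_mem_resolventSpan {f : ℝ →ᵇ ℂ} (hf : f ∈ resolventSpan) :
    star f ∈ resolventSpan := by
  refine Submodule.span_induction (p := fun f _ => star f ∈ resolventSpan) ?_ ?_ ?_ ?_ hf
  · rintro f (rfl | ⟨r, rfl⟩)
    · rw [star_one]; exact Submodule.subset_span (Or.inl rfl)
    · simp only [star_imagResolvent]
      exact imagResolvent_mem_resolventSpan _
  · rw [star_zero]; exact Submodule.zero_mem _
  · intro a b _ _ h1 h2; rw [star_add]; exact Submodule.add_mem _ h1 h2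
  · intro c a _ h; rw [star_smul]; exact Submodule.smul_mem _ _ h

/-- The uniform closure of the span of the constants and the functions `x ↦ 1 / (x - i r)` is a
star subalgebra of the bounded continuous functions. -/
noncomputable def resolventAlgebra : StarSubalgebra ℂ (ℝ →ᵇ ℂ) where
  carrier := resolventSpan.topologicalClosure
  mul_mem' {a b} ha hb := by
    have h := map_mem_closure₂ (s := (resolventSpan : Set (ℝ →ᵇ ℂ)))
      (t := (resolventSpan : Set (ℝ →ᵇ ℂ)))
      (u := (resolventSpan.topologicalClosure : Set (ℝ →ᵇ ℂ)))
      continuous_mul ha hb (fun f hf g hg => mul_mem_closure_resolventSpan hf hg)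
    rwa [resolventSpan.isClosed_topologicalClosure.closure_eq] at h
  add_mem' ha hb := Submodule.add_mem _ ha hb
  algebraMap_mem' c := by
    rw [Algebra.algebraMap_eq_smul_one]
    exact Submodule.smul_mem _ _
      (resolventSpan.le_topologicalClosure (Submodule.subset_span (Or.inl rfl)))
  star_mem' {a} ha :=
    map_mem_closure continuous_star ha (fun f hf => star_mem_resolventSpan hf)

theorem separatesPoints_resolventAlgebra :
    (resolventAlgebra.map
      (BoundedContinuousFunction.toContinuousMapStarₐ ℂ)).SeparatesPoints := by
  intro x y hxy
  refine ⟨_, ⟨_, ⟨imagResolvent 1 one_ne_zero,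
    resolventSpan.le_topologicalClosure (imagResolvent_mem_resolventSpan _), rfl⟩, rfl⟩, ?_⟩
  intro h
  apply hxy
  change ((x : ℂ) - (1 : ℝ) * Complex.I)⁻¹ = ((y : ℂ) - (1 : ℝ) * Complex.I)⁻¹ at h
  have h2 := inv_injective h
  simpa using h2

theorem isClosed_setOf_tendsto_integral (μ : ℕ → ProbabilityMeasure ℝ)
    (μ₀ : ProbabilityMeasure ℝ) :
    IsClosed {g : ℝ →ᵇ ℂ | Tendsto (fun n => ∫ x, g x ∂(μ n : Measure ℝ)) atTop
      (𝓝 (∫ x, g x ∂(μ₀ : Measure ℝ)))} := by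
  have key : ∀ (m : ProbabilityMeasure ℝ) (f g : ℝ →ᵇ ℂ),
      dist (∫ x, f x ∂(m : Measure ℝ)) (∫ x, g x ∂(m : Measure ℝ)) ≤ dist f g := by
    intro m f g
    rw [dist_eq_norm, dist_eq_norm, ← integral_sub (f.integrable _) (g.integrable _)]
    refine (norm_integral_le_of_norm_le_const (C := ‖f - g‖)
      (Eventually.of_forall fun x => (f - g).norm_coe_le_norm x)).trans ?_
    simp
  refine isClosed_of_closure_subset fun g hg => ?_
  rw [Metric.mem_closure_iff] at hg
  rw [Set.mem_ofPred_eq, Metric.tendsto_atTop]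
  intro ε hε
  obtain ⟨f, hf, hfg⟩ := hg (ε / 3) (by positivity)
  rw [Set.mem_ofPred_eq, Metric.tendsto_atTop] at hf
  obtain ⟨N, hN⟩ := hf (ε / 3) (by positivity)
  refine ⟨N, fun n hn => ?_⟩
  have h1 := key (μ n) g f
  have h2 := key μ₀ f g
  rw [dist_comm f g] at h2
  have h3 := hN n hn
  calc _ ≤ _ := dist_triangle4 _ (∫ x, f x ∂(μ n : Measure ℝ)) (∫ x, f x ∂(μ₀ : Measure ℝ)) _
    _ < ε := by linarith

/-- Convergence of the integrals of `1 / (x - i q)` for rational `q` gives convergence for every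
function of `resolventAlgebra`. -/
theorem tendsto_integral_of_mem_resolventAlgebra {μ : ℕ → ProbabilityMeasure ℝ}
    {μ₀ : ProbabilityMeasure ℝ}
    (h : ∀ q : ℚ, q ≠ 0 → Tendsto
      (fun n => ∫ x : ℝ, ((x : ℂ) - ((q : ℝ) : ℂ) * Complex.I)⁻¹ ∂(μ n : Measure ℝ)) atTop
      (𝓝 (∫ x : ℝ, ((x : ℂ) - ((q : ℝ) : ℂ) * Complex.I)⁻¹ ∂(μ₀ : Measure ℝ))))
    {g : ℝ →ᵇ ℂ} (hg : g ∈ resolventAlgebra) :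
    Tendsto (fun n => ∫ x, g x ∂(μ n : Measure ℝ)) atTop (𝓝 (∫ x, g x ∂(μ₀ : Measure ℝ))) := by
  refine closure_minimal ?_ (isClosed_setOf_tendsto_integral μ μ₀) hg
  intro f hf
  refine Submodule.span_induction (p := fun f _ => f ∈ {g : ℝ →ᵇ ℂ | Tendsto
    (fun n => ∫ x, g x ∂(μ n : Measure ℝ)) atTop
      (𝓝 (∫ x, g x ∂(μ₀ : Measure ℝ)))}) ?_ ?_ ?_ ?_ hf
  · rintro f (rfl | ⟨⟨r, hr⟩, rfl⟩)
    · simp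
    · -- rational points `q n ≠ 0` increasing to `r` reduce the claim to the hypothesis
      have hq : ∀ n : ℕ, ∃ q : ℚ, q ≠ 0 ∧ |r - q| < 1 / ((n : ℝ) + 1) := by
        intro n
        have hpos : (0 : ℝ) < min |r| (1 / ((n : ℝ) + 1)) :=
          lt_min (abs_pos.mpr hr) (by positivity)
        obtain ⟨q, hq⟩ := Rat.denseRange_cast.exists_dist_lt r hpos
        rw [Real.dist_eq, lt_min_iff] at hq
        refine ⟨q, ?_, hq.2⟩
        rintro rfl
        simp at hq
      choose q hq0 hq1 using hq
      have hq0' : ∀ n, ((q n : ℚ) : ℝ) ≠ 0 := fun n => by exact_mod_cast hq0 n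
      have hlim : Tendsto (fun n => ((q n : ℚ) : ℝ)) atTop (𝓝 r) := by
        rw [tendsto_iff_dist_tendsto_zero]
        refine squeeze_zero (fun _ => dist_nonneg) (fun n => ?_)
          (tendsto_one_div_add_atTop_nhds_zero_nat (𝕜 := ℝ))
        rw [dist_comm, Real.dist_eq]
        exact (hq1 n).le
      exact (isClosed_setOf_tendsto_integral μ μ₀).mem_of_tendsto
        (tendsto_imagResolvent hr hq0' hlim) (Eventually.of_forall fun n => h (q n) (hq0 n))
  · simp
  · intro a b _ _ ha hb
    have := Tendsto.add ha hb
    simpa [integral_add (a.integrable _) (b.integrable _)] using this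
  · intro c a _ ha
    have := Tendsto.const_mul c ha
    simpa [integral_const_mul] using this

/-- The mass of a probability measure outside `[-r, r]` is controlled by the imaginary part of the
integral of `1 / (x - i r)`. -/
theorem measureReal_abs_gt_le {r : ℝ} (hr : 0 < r) (m : ProbabilityMeasure ℝ) :
    (m : Measure ℝ).real {x | r < |x|} ≤
      2 * (1 - r * (∫ x, imagResolvent r hr.ne' x ∂(m : Measure ℝ)).im) := by
  have hint := (imagResolvent r hr.ne').integrable (m : Measure ℝ)
  have him : (∫ x, imagResolvent r hr.ne' x ∂(m : Measure ℝ)).im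
      = ∫ x, (imagResolvent r hr.ne' x).im ∂(m : Measure ℝ) := by
    simpa using (integral_im hint).symm
  have hval : ∀ x : ℝ, (imagResolvent r hr.ne' x).im = r / (x ^ 2 + r ^ 2) := by
    intro x
    simp [Complex.inv_im, Complex.normSq_apply, pow_two]
  have hint2 : Integrable (fun x => 2 * (1 - r * (imagResolvent r hr.ne' x).im))
      (m : Measure ℝ) :=
    ((integrable_const _).sub ((hint.im).const_mul r)).const_mul 2
  have hrhs : 2 * (1 - r * (∫ x, imagResolvent r hr.ne' x ∂(m : Measure ℝ)).im)
      = ∫ x, 2 * (1 - r * (imagResolvent r hr.ne' x).im) ∂(m : Measure ℝ) := by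
    rw [integral_const_mul, integral_sub (integrable_const _)
      (Integrable.const_mul (f := fun x => (imagResolvent r hr.ne' x).im) hint.im r),
      integral_const_mul, him]
    simp
  have hms : MeasurableSet {x : ℝ | r < |x|} :=
    measurableSet_lt measurable_const (by fun_prop)
  rw [hrhs, ← integral_indicator_one hms]
  refine integral_mono ((integrable_const (1 : ℝ)).indicator hms) hint2 fun x => ?_
  simp only [hval]
  have hpos : 0 < x ^ 2 + r ^ 2 := by positivity
  have h1 : 1 - r * (r / (x ^ 2 + r ^ 2)) = x ^ 2 / (x ^ 2 + r ^ 2) := by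
    field_simp; ring
  rw [h1]
  by_cases hx : r < |x|
  · rw [Set.indicator_of_mem (by exact hx)]
    have : r ^ 2 ≤ x ^ 2 := by
      rw [← sq_abs x]; gcongr
    rw [Pi.one_apply, ← mul_div_assoc, le_div_iff₀ hpos]
    linarith
  · rw [Set.indicator_of_notMem (by exact hx)]
    positivity

theorem tendsto_mul_im_integral_imagResolvent (m : ProbabilityMeasure ℝ) :
    Tendsto (fun r : ℝ => r * (∫ x : ℝ, ((x : ℂ) - r * Complex.I)⁻¹ ∂(m : Measure ℝ)).im)
      atTop (𝓝 1) := by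
  have h1 : Tendsto (fun r : ℝ => ∫ x : ℝ, r ^ 2 / (x ^ 2 + r ^ 2) ∂(m : Measure ℝ))
      atTop (𝓝 (∫ _ : ℝ, (1 : ℝ) ∂(m : Measure ℝ))) := by
    refine tendsto_integral_filter_of_dominated_convergence (fun _ => 1) ?_ ?_
      (integrable_const _) ?_
    · filter_upwards with r
      exact Measurable.aestronglyMeasurable (by fun_prop)
    · filter_upwards [eventually_gt_atTop 0] with r hr
      filter_upwards with x
      rw [Real.norm_eq_abs, abs_of_nonneg (by positivity), div_le_one (by positivity)]
      nlinarith [sq_nonneg x]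
    · filter_upwards with x
      have : Tendsto (fun r : ℝ => (x ^ 2 / r ^ 2 + 1)⁻¹) atTop (𝓝 ((0 + 1)⁻¹)) := by
        refine Tendsto.inv₀ (Tendsto.add ?_ tendsto_const_nhds) (by norm_num)
        exact tendsto_const_nhds.div_atTop (tendsto_pow_atTop two_ne_zero)
      rw [zero_add, inv_one] at this
      refine this.congr' ?_
      filter_upwards [eventually_gt_atTop 0] with r hr
      field_simp
  simp only [integral_const, smul_eq_mul, mul_one, probReal_univ] at h1
  refine h1.congr' ?_
  filter_upwards [eventually_gt_atTop 0] with r hr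
  have hint := (imagResolvent r hr.ne').integrable (m : Measure ℝ)
  have him : (∫ x : ℝ, ((x : ℂ) - r * Complex.I)⁻¹ ∂(m : Measure ℝ)).im
      = ∫ x, (imagResolvent r hr.ne' x).im ∂(m : Measure ℝ) := by
    simpa using (integral_im hint).symm
  rw [him, ← integral_const_mul]
  refine integral_congr_ae (Eventually.of_forall fun x => ?_)
  simp [Complex.inv_im, Complex.normSq_apply, pow_two]
  ring

/-- A tightness criterion: the Stieltjes transforms on the imaginary axis converge to that of a
probability measure. -/
theorem isTightMeasureSet_of_tendsto_integral_resolvent {μ : ℕ → ProbabilityMeasure ℝ}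
    {μ₀ : ProbabilityMeasure ℝ}
    (h : ∀ q : ℚ, q ≠ 0 → Tendsto
      (fun n => ∫ x : ℝ, ((x : ℂ) - ((q : ℝ) : ℂ) * Complex.I)⁻¹ ∂(μ n : Measure ℝ)) atTop
      (𝓝 (∫ x : ℝ, ((x : ℂ) - ((q : ℝ) : ℂ) * Complex.I)⁻¹ ∂(μ₀ : Measure ℝ)))) :
    IsTightMeasureSet (Set.range fun n => (μ n : Measure ℝ)) := by
  have hlim : ∀ r (hr : 0 < r), Tendsto
      (fun n => 2 * (1 - r * (∫ x, imagResolvent r hr.ne' x ∂(μ n : Measure ℝ)).im)) atTop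
      (𝓝 (2 * (1 - r * (∫ x, imagResolvent r hr.ne' x ∂(μ₀ : Measure ℝ)).im))) := by
    intro r hr
    have := tendsto_integral_of_mem_resolventAlgebra h
      (resolventSpan.le_topologicalClosure (imagResolvent_mem_resolventSpan hr.ne'))
    exact (((((Complex.continuous_im.tendsto _).comp this).const_mul r).const_sub 1).const_mul 2)
  have hbdd : ∀ r : ℝ, IsBoundedUnder (· ≤ ·) atTop
      (fun n => (μ n : Measure ℝ).real {x | r < |x|}) := fun r =>
    isBoundedUnder_of ⟨1, fun n => measureReal_le_one⟩
  have hcobdd : ∀ r : ℝ, IsCoboundedUnder (· ≤ ·) atTop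
      (fun n => (μ n : Measure ℝ).real {x | r < |x|}) := fun r =>
    IsBoundedUnder.isCoboundedUnder_le (isBoundedUnder_of ⟨0, fun n => measureReal_nonneg⟩)
  refine isTightMeasureSet_range_of_tendsto_limsup_measureReal_inner_of_norm_eq_one ℝ
    (fun z hz => ?_) 1 (Eventually.of_forall fun n => by simp)
  have hset : ∀ r : ℝ, {x : ℝ | r < ‖inner ℝ z x‖} = {x | r < |x|} := by
    intro r
    ext x
    have : ‖inner ℝ z x‖ = |x| := by
      rw [Real.norm_eq_abs] at hz
      simp [hz]
    simp only [Set.mem_ofPred_eq, this]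
  simp only [hset]
  have h0 : Tendsto (fun r : ℝ => 2 * (1 - r *
      (∫ x : ℝ, ((x : ℂ) - r * Complex.I)⁻¹ ∂(μ₀ : Measure ℝ)).im)) atTop (𝓝 0) := by
    have := ((tendsto_mul_im_integral_imagResolvent μ₀).const_sub 1).const_mul 2
    simpa using this
  refine tendsto_of_tendsto_of_tendsto_of_le_of_le' tendsto_const_nhds h0 ?_ ?_
  · filter_upwards with r
    exact le_limsup_of_le (hbdd r) fun u hu => measureReal_nonneg.trans hu.exists.choose_spec
  · filter_upwards [eventually_gt_atTop 0] with r hr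
    rw [show (∫ x : ℝ, ((x : ℂ) - r * Complex.I)⁻¹ ∂(μ₀ : Measure ℝ))
      = ∫ x, imagResolvent r hr.ne' x ∂(μ₀ : Measure ℝ) from rfl, ← (hlim r hr).limsup_eq]
    exact limsup_le_limsup (Eventually.of_forall fun n => measureReal_abs_gt_le hr (μ n))
      (hcobdd r) (hlim r hr).isBoundedUnder_le

/-- Convergence of the Stieltjes transforms at the points `i q`, `q` a nonzero rational, implies
weak convergence. -/
theorem tendsto_of_tendsto_integral_resolvent {μ : ℕ → ProbabilityMeasure ℝ}
    {μ₀ : ProbabilityMeasure ℝ}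
    (h : ∀ q : ℚ, q ≠ 0 → Tendsto
      (fun n => ∫ x : ℝ, ((x : ℂ) - ((q : ℝ) : ℂ) * Complex.I)⁻¹ ∂(μ n : Measure ℝ)) atTop
      (𝓝 (∫ x : ℝ, ((x : ℂ) - ((q : ℝ) : ℂ) * Complex.I)⁻¹ ∂(μ₀ : Measure ℝ)))) :
    Tendsto μ atTop (𝓝 μ₀) :=
  ProbabilityMeasure.tendsto_of_tight_of_separatesPoints ℂ
    (isTightMeasureSet_of_tendsto_integral_resolvent h) separatesPoints_resolventAlgebra
    fun _ hg => tendsto_integral_of_mem_resolventAlgebra h hg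

theorem tendsto_measureReal_Iic_of_tendsto_integral_resolvent {μ : ℕ → ProbabilityMeasure ℝ}
    {μ₀ : ProbabilityMeasure ℝ} [NullSingletonClass (μ₀ : Measure ℝ)]
    (h : ∀ q : ℚ, q ≠ 0 → Tendsto
      (fun n => ∫ x : ℝ, ((x : ℂ) - ((q : ℝ) : ℂ) * Complex.I)⁻¹ ∂(μ n : Measure ℝ)) atTop
      (𝓝 (∫ x : ℝ, ((x : ℂ) - ((q : ℝ) : ℂ) * Complex.I)⁻¹ ∂(μ₀ : Measure ℝ)))) (x : ℝ) :
    Tendsto (fun n => (μ n : Measure ℝ).real (Set.Iic x)) atTop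
      (𝓝 ((μ₀ : Measure ℝ).real (Set.Iic x))) := by
  have := ProbabilityMeasure.tendsto_measure_of_null_frontier_of_tendsto'
    (tendsto_of_tendsto_integral_resolvent h) (E := Set.Iic x) (by simp)
  exact (ENNReal.tendsto_toReal (measure_ne_top _ _)).comp this

/-! ### The semicircle law and its Stieltjes transform -/

/-- The truncation in the definition of the density is automatic, as `Real.sqrt` vanishes on
negative numbers. -/
theorem semicircleDensity_eq_sqrt (α : ℝ) {β : ℝ} (hβ : 0 < β) (t : ℝ) :
    semicircleDensity α β t =
      1 / (2 * Real.pi * β ^ 2) * Real.sqrt (4 * β ^ 2 - (t - α) ^ 2) := by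
  unfold semicircleDensity
  split_ifs with h
  · rfl
  · rw [Real.sqrt_eq_zero_of_nonpos, mul_zero]
    rw [not_le] at h
    have : (2 * β) ^ 2 < |t - α| ^ 2 := by gcongr
    rw [sq_abs] at this
    linarith

theorem continuous_semicircleDensity (α : ℝ) {β : ℝ} (hβ : 0 < β) :
    Continuous (semicircleDensity α β) := by
  rw [funext (semicircleDensity_eq_sqrt α hβ)]
  fun_prop

theorem semicircleDensity_nonneg (α β t : ℝ) : 0 ≤ semicircleDensity α β t := by
  unfold semicircleDensity
  split_ifs <;> positivity

theorem support_semicircleDensity_subset (α β : ℝ) :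
    Function.support (semicircleDensity α β) ⊆ Set.Icc (α - 2 * β) (α + 2 * β) := by
  intro t ht
  have : |t - α| ≤ 2 * β := by
    by_contra h
    exact ht (if_neg h)
  rw [abs_le] at this
  constructor <;> linarith

theorem integrable_semicircleDensity (α : ℝ) {β : ℝ} (hβ : 0 < β) :
    Integrable (semicircleDensity α β) :=
  (continuous_semicircleDensity α hβ).integrable_of_hasCompactSupport
    (HasCompactSupport.of_support_subset_isCompact isCompact_Icc
      (support_semicircleDensity_subset α β))

/-- The substitution `t = α + 2β cos θ`. -/
theorem integral_semicircleDensity_smul {E : Type*} [NormedAddCommGroup E] [NormedSpace ℝ E]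
    (α : ℝ) {β : ℝ} (hβ : 0 < β) {g : ℝ → E} (hg : Continuous g) :
    ∫ t, semicircleDensity α β t • g t =
      ∫ θ in (0 : ℝ)..Real.pi, (2 / Real.pi * Real.sin θ ^ 2) • g (α + 2 * β * Real.cos θ) := by
  have h1 : ∫ t, semicircleDensity α β t • g t =
      ∫ t in (α - 2 * β)..(α + 2 * β), semicircleDensity α β t • g t := by
    rw [intervalIntegral.integral_of_le (by linarith), ← integral_Icc_eq_integral_Ioc,
      setIntegral_eq_integral_of_forall_compl_eq_zero]
    intro t ht
    have : semicircleDensity α β t = 0 := by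
      by_contra h
      exact ht (support_semicircleDensity_subset α β h)
    rw [this, zero_smul]
  have hd : ∀ θ ∈ Set.uIcc 0 Real.pi, HasDerivAt (fun θ => α + 2 * β * Real.cos θ)
      (2 * β * -Real.sin θ) θ := fun θ _ =>
    ((Real.hasDerivAt_cos θ).const_mul (2 * β)).const_add α
  have h2 := intervalIntegral.integral_deriv_smul_comp
    (g := fun t => semicircleDensity α β t • g t) hd
    (by fun_prop) ((continuous_semicircleDensity α hβ).smul hg)
  have e0 : α + 2 * β * Real.cos 0 = α + 2 * β := by simp
  have eπ : α + 2 * β * Real.cos Real.pi = α - 2 * β := by simp; ring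
  rw [e0, eπ] at h2
  rw [h1, intervalIntegral.integral_symm, ← h2, ← intervalIntegral.integral_neg]
  refine intervalIntegral.integral_congr fun θ hθ => ?_
  rw [Set.uIcc_of_le Real.pi_pos.le] at hθ
  have hs : 0 ≤ Real.sin θ := Real.sin_nonneg_of_mem_Icc hθ
  simp only [Function.comp_apply]
  rw [← neg_smul, smul_smul, semicircleDensity_eq_sqrt α hβ,
    show 4 * β ^ 2 - (α + 2 * β * Real.cos θ - α) ^ 2 = (2 * β * Real.sin θ) ^ 2 by
      rw [mul_pow _ (Real.sin θ), Real.sin_sq]; ring, Real.sqrt_sq (by positivity)]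
  congr 1
  have := Real.pi_pos
  field_simp

theorem isProbabilityMeasure_semicircleLaw (α : ℝ) {β : ℝ} (hβ : 0 < β) :
    IsProbabilityMeasure (semicircleLaw α β) := by
  constructor
  have h := integral_semicircleDensity_smul α hβ (g := fun _ => (1 : ℝ)) continuous_const
  simp only [smul_eq_mul, mul_one, intervalIntegral.integral_const_mul, integral_sin_sq] at h
  rw [semicircleLaw, withDensity_apply _ MeasurableSet.univ, Measure.restrict_univ,
    ← ofReal_integral_eq_lintegral_ofReal (integrable_semicircleDensity α hβ)
      (Eventually.of_forall (semicircleDensity_nonneg α β)), h]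
  have : (2 : ℝ) / Real.pi * ((Real.sin 0 * Real.cos 0 - Real.sin Real.pi * Real.cos Real.pi
      + Real.pi - 0) / 2) = 1 := by
    simp [Real.pi_ne_zero]
  rw [this, ENNReal.ofReal_one]

theorem integral_semicircleLaw (α : ℝ) {β : ℝ} (hβ : 0 < β) {g : ℝ → ℂ} (hg : Continuous g) :
    ∫ t, g t ∂(semicircleLaw α β) =
      ∫ θ in (0 : ℝ)..Real.pi, (2 / Real.pi * Real.sin θ ^ 2) • g (α + 2 * β * Real.cos θ) := by
  rw [← integral_semicircleDensity_smul α hβ hg, semicircleLaw,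
    integral_withDensity_eq_integral_toReal_smul
      (by have := (continuous_semicircleDensity α hβ).measurable; fun_prop)
      (Eventually.of_forall fun _ => ENNReal.ofReal_lt_top)]
  simp only [ENNReal.toReal_ofReal (semicircleDensity_nonneg α β _)]

/-- For nonreal `z`, the quadratic equation `m ^ 2 + z m + 1 = 0` has a root in the open unit
disc; the other root is its inverse. -/
theorem exists_root_norm_lt_one {z : ℂ} (hz : z.im ≠ 0) :
    ∃ m : ℂ, m ^ 2 + z * m + 1 = 0 ∧ ‖m‖ < 1 := by
  obtain ⟨m, hm⟩ : ∃ m : ℂ, m ^ 2 + z * m + 1 = 0 := by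
    obtain ⟨w, hw⟩ := IsAlgClosed.exists_pow_nat_eq (z ^ 2 - 4) (n := 2) two_pos
    exact ⟨(-z + w) / 2, by linear_combination hw / 4⟩
  have hm0 : m ≠ 0 := by rintro rfl; simp at hm
  rcases lt_trichotomy ‖m‖ 1 with h | h | h
  · exact ⟨m, hm, h⟩
  · exfalso
    apply hz
    have hinv : m⁻¹ = (starRingEnd ℂ) m := Complex.inv_eq_conj h
    have hzm : z = -(m + m⁻¹) := by field_simp; linear_combination hm
    rw [hzm, hinv]
    simp
  · refine ⟨m⁻¹, ?_, ?_⟩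
    · field_simp
      linear_combination hm
    · rw [norm_inv]
      exact inv_lt_one_of_one_lt₀ h

theorem one_add_mul_ne_zero {m ζ : ℂ} (hm : ‖m‖ < 1) (hζ : ‖ζ‖ ≤ 1) : 1 + m * ζ ≠ 0 := by
  intro h
  have h1 : m * ζ = -1 := by linear_combination h
  have h2 : ‖m‖ * ‖ζ‖ = 1 := by rw [← norm_mul, h1]; simp
  nlinarith [norm_nonneg m, norm_nonneg ζ]

/-- Cauchy's formula for `(1 - ζ²) / (1 + m ζ)` at the point `-m` of the unit disc. -/
theorem integral_zero_two_pi_eq {m : ℂ} (hm : ‖m‖ < 1) :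
    ∫ θ : ℝ in (0 : ℝ)..(2 * Real.pi), (1 - Complex.exp (θ * Complex.I) ^ 2) /
      ((1 + m * (Complex.exp (θ * Complex.I))⁻¹) * (1 + m * Complex.exp (θ * Complex.I)))
      = 2 * (Real.pi : ℂ) := by
  have hf : DiffContOnCl ℂ (fun ζ : ℂ => (1 - ζ ^ 2) / (1 + m * ζ)) (Metric.ball 0 1) := by
    refine DifferentiableOn.diffContOnCl fun ζ hζ => ?_
    rw [closure_ball _ one_ne_zero, mem_closedBall_zero_iff] at hζ
    refine DifferentiableAt.differentiableWithinAt ?_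
    exact DifferentiableAt.div (by fun_prop) (by fun_prop) (one_add_mul_ne_zero hm hζ)
  have h := hf.circleIntegral_sub_inv_smul (w := -m) (by simpa using hm)
  have hden : 1 + m * -m ≠ 0 := one_add_mul_ne_zero hm (by rw [norm_neg]; exact hm.le)
  rw [show (1 - (-m) ^ 2) / (1 + m * -m) = 1 by
    rw [show 1 - (-m) ^ 2 = 1 + m * -m by ring]; exact div_self hden] at h
  rw [circleIntegral] at h
  have h2 : ∫ θ : ℝ in (0 : ℝ)..(2 * Real.pi), Complex.I * ((1 - Complex.exp (θ * Complex.I) ^ 2) /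
      ((1 + m * (Complex.exp (θ * Complex.I))⁻¹) * (1 + m * Complex.exp (θ * Complex.I))))
      = (2 * Real.pi * Complex.I) • (1 : ℂ) := by
    rw [← h]
    refine intervalIntegral.integral_congr fun θ _ => ?_
    simp only [deriv_circleMap, circleMap_zero, Complex.ofReal_one, one_mul, smul_eq_mul]
    set ζ := Complex.exp (θ * Complex.I) with hζdef
    have hζ : ‖ζ‖ = 1 := Complex.norm_exp_ofReal_mul_I θ
    have hζ0 : ζ ≠ 0 := Complex.exp_ne_zero _
    have ha := one_add_mul_ne_zero hm hζ.le
    have hb : 1 + m * ζ⁻¹ ≠ 0 := one_add_mul_ne_zero hm (by rw [norm_inv, hζ, inv_one])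
    have hc : ζ - -m = ζ * (1 + m * ζ⁻¹) := by field_simp; ring
    rw [hc]
    field_simp
  rw [intervalIntegral.integral_const_mul, smul_eq_mul, mul_one, mul_comm _ Complex.I] at h2
  exact mul_left_cancel₀ Complex.I_ne_zero h2

theorem integral_sin_sq_div_eq {m : ℂ} (hm : ‖m‖ < 1) :
    ∫ θ in (0 : ℝ)..Real.pi, ((2 / Real.pi * Real.sin θ ^ 2 : ℝ) : ℂ) /
      (1 + 2 * m * Real.cos θ + m ^ 2) = 1 := by
  set h : ℝ → ℂ := fun θ => (1 - Complex.exp (θ * Complex.I) ^ 2) /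
      ((1 + m * (Complex.exp (θ * Complex.I))⁻¹) * (1 + m * Complex.exp (θ * Complex.I)))
    with hh
  have hne1 : ∀ θ : ℝ, 1 + m * Complex.exp (θ * Complex.I) ≠ 0 := fun θ =>
    one_add_mul_ne_zero hm (Complex.norm_exp_ofReal_mul_I θ).le
  have hne2 : ∀ θ : ℝ, 1 + m * (Complex.exp (θ * Complex.I))⁻¹ ≠ 0 := fun θ =>
    one_add_mul_ne_zero hm (by rw [norm_inv, Complex.norm_exp_ofReal_mul_I, inv_one])
  have hcont : Continuous h := by
    refine Continuous.div (by fun_prop) ?_ fun θ => mul_ne_zero (hne2 θ) (hne1 θ)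
    refine Continuous.mul (continuous_const.add (continuous_const.mul
      (Continuous.inv₀ (by fun_prop) fun θ => Complex.exp_ne_zero _))) (by fun_prop)
  have hfull : ∫ θ in (0 : ℝ)..(2 * Real.pi), h θ = 2 * Real.pi := integral_zero_two_pi_eq hm
  have hreflect : ∫ θ in Real.pi..(2 * Real.pi), h θ
      = ∫ θ in (0 : ℝ)..Real.pi, h (2 * Real.pi - θ) := by
    rw [intervalIntegral.integral_comp_sub_left]
    congr 1 <;> ring
  rw [← intervalIntegral.integral_add_adjacent_intervals (b := Real.pi)
    (hcont.intervalIntegrable _ _) (hcont.intervalIntegrable _ _), hreflect,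
    ← intervalIntegral.integral_add (hcont.intervalIntegrable _ _)
      (Continuous.intervalIntegrable
        (u := fun θ => h (2 * Real.pi - θ)) (hcont.comp (by fun_prop)) _ _)] at hfull
  have hpi : (Real.pi : ℂ) ≠ 0 := by exact_mod_cast Real.pi_ne_zero
  have hpt : ∀ θ : ℝ, ((2 / Real.pi * Real.sin θ ^ 2 : ℝ) : ℂ) /
      (1 + 2 * m * Real.cos θ + m ^ 2) =
      (1 / (2 * Real.pi)) * (h θ + h (2 * Real.pi - θ)) := by
    intro θ
    set ζ := Complex.exp (θ * Complex.I) with hζdef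
    have hζ0 : ζ ≠ 0 := Complex.exp_ne_zero _
    have hrefl : Complex.exp (((2 * Real.pi - θ : ℝ) : ℂ) * Complex.I) = ζ⁻¹ := by
      rw [hζdef, ← Complex.exp_neg]
      push_cast
      rw [sub_mul, Complex.exp_sub, Complex.exp_two_pi_mul_I, Complex.exp_neg, one_div]
    have hcos : (Real.cos θ : ℂ) = (ζ + ζ⁻¹) / 2 := by
      rw [hζdef, ← Complex.exp_neg, Complex.ofReal_cos, Complex.cos, neg_mul]
    have hsin : (Real.sin θ : ℂ) ^ 2 = 1 - ((ζ + ζ⁻¹) / 2) ^ 2 := by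
      rw [← hcos, Complex.ofReal_sin, Complex.ofReal_cos, Complex.sin_sq]
    have ha := hne1 θ
    have hb := hne2 θ
    rw [← hζdef] at ha hb
    simp only [hh, hrefl, inv_inv, ← hζdef]
    have hden : 1 + 2 * m * ((ζ + ζ⁻¹) / 2) + m ^ 2 = (1 + m * ζ⁻¹) * (1 + m * ζ) := by
      field_simp; ring
    rw [Complex.ofReal_mul, Complex.ofReal_pow, hsin, hcos, hden,
      mul_comm (1 + m * ζ) (1 + m * ζ⁻¹), ← add_div, ← mul_div_assoc]
    congr 1
    push_cast
    field_simp
    ring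
  simp_rw [hpt]
  rw [intervalIntegral.integral_const_mul, hfull]
  field_simp

/-- The Stieltjes transform of the semicircle law at `w` is `m / β`, where `m` is the root in the
unit disc of the quadratic equation `m ^ 2 + z m + 1 = 0` with `z = (w - α) / β`. -/
theorem integral_semicircleLaw_inv_sub (α : ℝ) {β : ℝ} (hβ : 0 < β) {w m : ℂ} (hw : w.im ≠ 0)
    (hm : m ^ 2 + (w - α) / β * m + 1 = 0) (hm1 : ‖m‖ < 1) :
    ∫ t : ℝ, ((t : ℂ) - w)⁻¹ ∂(semicircleLaw α β) = m / β := by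
  have hne : ∀ t : ℝ, (t : ℂ) - w ≠ 0 := fun t h => hw (by simpa using congrArg Complex.im h)
  have hβ' : (β : ℂ) ≠ 0 := by exact_mod_cast hβ.ne'
  have hm0 : m ≠ 0 := by rintro rfl; simp at hm
  rw [integral_semicircleLaw α hβ (g := fun t : ℝ => ((t : ℂ) - w)⁻¹)
    (Continuous.inv₀ (by fun_prop) hne)]
  calc _ = ∫ θ in (0 : ℝ)..Real.pi, m / β * (((2 / Real.pi * Real.sin θ ^ 2 : ℝ) : ℂ) /
      (1 + 2 * m * Real.cos θ + m ^ 2)) := by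
        refine intervalIntegral.integral_congr fun θ _ => ?_
        have h1 : ((α + 2 * β * Real.cos θ : ℝ) : ℂ) - w
            = β * (1 + 2 * m * Real.cos θ + m ^ 2) / m := by
          field_simp at hm ⊢
          push_cast
          linear_combination (-1 : ℂ) * hm
        simp only [Complex.real_smul]
        rw [h1, inv_div, div_mul_div_comm, mul_comm m, mul_div_assoc]
    _ = _ := by
        rw [intervalIntegral.integral_const_mul, integral_sin_sq_div_eq hm1, mul_one]

/-! ### The bounded differences inequality -/

/-- The inductive step integrates out one coordinate, for which Hoeffding's lemma applies. -/
theorem integral_exp_le_of_bounded_differences {E : Type*} [MeasurableSpace E] (c : ℝ≥0) (t : ℝ)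
    (n : ℕ) (m : Fin n → Measure E) [∀ i, IsProbabilityMeasure (m i)] (f : (Fin n → E) → ℝ)
    (hf : Measurable f) (C : ℝ) (hb : ∀ x, |f x| ≤ C)
    (hdiff : ∀ x i y, |f (Function.update x i y) - f x| ≤ c) :
    ∫ x, Real.exp (t * (f x - ∫ y, f y ∂(Measure.pi m))) ∂(Measure.pi m)
      ≤ Real.exp (n * c ^ 2 * t ^ 2 / 2) := by
  induction n with
  | zero =>
    have hx : ∀ x y : Fin 0 → E, f x = f y := fun x y => congrArg f (Subsingleton.elim x y)
    have : ∀ x : Fin 0 → E, f x - ∫ y, f y ∂(Measure.pi m) = 0 := by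
      intro x
      rw [integral_congr_ae (Eventually.of_forall fun y => hx y x)]
      simp
    simp [this]
  | succ n ih =>
    set ρ : Measure (Fin n → E) := Measure.pi fun j => m j.succ with hρ
    set F : E × (Fin n → E) → ℝ := fun p => f (Fin.cons p.1 p.2) with hF
    have hcons : Measurable fun p : E × (Fin n → E) => (Fin.cons p.1 p.2 : Fin (n + 1) → E) := by
      refine measurable_pi_lambda _ fun i => ?_
      refine Fin.cases ?_ (fun j => ?_) i
      · simpa using measurable_fst
      · simp only [Fin.cons_succ]; fun_prop
    have hFm : Measurable F := hf.comp hcons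
    have hFb : ∀ p, |F p| ≤ C := fun p => hb _
    have htransfer : ∀ φ : (Fin (n + 1) → E) → ℝ,
        ∫ x, φ x ∂(Measure.pi m) = ∫ p, φ (Fin.cons p.1 p.2) ∂((m 0).prod ρ) := by
      intro φ
      have h := (measurePreserving_piFinSuccAbove m 0).symm.integral_comp' φ
      rw [← h]
      simp only [Fin.succAbove_zero, ← hρ]
      refine integral_congr_ae (Eventually.of_forall fun p => ?_)
      change φ (Fin.insertNth 0 p.1 p.2) = _
      rw [Fin.insertNth_zero']
    set g : (Fin n → E) → ℝ := fun xs => ∫ a, F (a, xs) ∂(m 0) with hg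
    have hgm : Measurable g := hFm.stronglyMeasurable.integral_prod_left'.measurable
    have hC : 0 ≤ C := (abs_nonneg _).trans (hb fun _ => (m 0).nonempty_of_neZero.some)
    have hFsec : ∀ xs, Measurable fun a => F (a, xs) := fun xs => hFm.comp (by fun_prop)
    have hFint : ∀ xs, Integrable (fun a => F (a, xs)) (m 0) := fun xs =>
      Integrable.of_bound (hFsec xs).aestronglyMeasurable C
        (Eventually.of_forall fun a => hFb _)
    have hgb : ∀ xs, |g xs| ≤ C := by
      intro xs
      have := norm_integral_le_of_norm_le_const (μ := m 0) (f := fun a => F (a, xs)) (C := C)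
        (Eventually.of_forall fun a => hFb _)
      simpa using this
    have hgdiff : ∀ xs i y, |g (Function.update xs i y) - g xs| ≤ c := by
      intro xs i y
      rw [hg]
      simp only
      rw [← integral_sub (hFint _) (hFint _)]
      have := norm_integral_le_of_norm_le_const (μ := m 0)
        (f := fun a => F (a, Function.update xs i y) - F (a, xs)) (C := c)
        (Eventually.of_forall fun a => by
          simp only [hF, Fin.cons_update]
          exact hdiff _ _ _)
      simpa using this
    have hEF : ∫ y, f y ∂(Measure.pi m) = ∫ xs, g xs ∂ρ := by
      rw [htransfer, integral_prod_symm]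
      exact Integrable.of_bound hFm.aestronglyMeasurable C (Eventually.of_forall hFb)
    set e := ∫ xs, g xs ∂ρ with he
    have heb : |e| ≤ C := by
      have := norm_integral_le_of_norm_le_const (μ := ρ) (f := g) (C := C)
        (Eventually.of_forall hgb)
      simpa using this
    have hexp : ∀ u : ℝ, |u| ≤ 2 * C → ‖Real.exp (t * u)‖ ≤ Real.exp (|t| * (2 * C)) := by
      intro u hu
      rw [Real.norm_eq_abs, Real.abs_exp]
      refine Real.exp_le_exp.mpr ((le_abs_self _).trans ?_)
      rw [abs_mul]
      gcongr
    have hsub : ∀ u v : ℝ, |u| ≤ C → |v| ≤ C → |u - v| ≤ 2 * C := fun u v hu hv =>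
      (abs_sub _ _).trans (by linarith)
    rw [hEF, htransfer, integral_prod_symm _
      (Integrable.of_bound (by fun_prop) (Real.exp (|t| * (2 * C)))
        (Eventually.of_forall fun p => hexp _ (hsub _ _ (hFb p) heb)))]
    have hinner : ∀ xs, ∫ a, Real.exp (t * (F (a, xs) - e)) ∂(m 0)
        ≤ Real.exp (c ^ 2 * t ^ 2 / 2) * Real.exp (t * (g xs - e)) := by
      intro xs
      obtain ⟨a₀⟩ := (m 0).nonempty_of_neZero
      have hmem : ∀ a, F (a, xs) ∈ Set.Icc (F (a₀, xs) - c) (F (a₀, xs) + c) := by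
        intro a
        have h := hdiff (Fin.cons a₀ xs) 0 a
        rw [Fin.update_cons_zero, abs_le] at h
        simp only [hF, Set.mem_Icc]
        constructor <;> linarith
      have hmgf := (hasSubgaussianMGF_of_mem_Icc (μ := m 0) (hFsec xs).aemeasurable
        (Eventually.of_forall hmem)).mgf_le t
      have hpar : (((‖F (a₀, xs) + c - (F (a₀, xs) - c)‖₊ / 2) ^ 2 : ℝ≥0) : ℝ) = c ^ 2 := by
        have : F (a₀, xs) + c - (F (a₀, xs) - c) = 2 * c := by ring
        rw [this]
        simp
      rw [hpar] at hmgf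
      have hsplit : ∀ a, Real.exp (t * (F (a, xs) - e))
          = Real.exp (t * (F (a, xs) - g xs)) * Real.exp (t * (g xs - e)) := by
        intro a
        rw [← Real.exp_add]
        ring_nf
      simp_rw [hsplit]
      rw [integral_mul_const]
      gcongr
      exact hmgf
    calc ∫ xs, ∫ a, Real.exp (t * (F (a, xs) - e)) ∂(m 0) ∂ρ
        ≤ ∫ xs, Real.exp (c ^ 2 * t ^ 2 / 2) * Real.exp (t * (g xs - e)) ∂ρ := by
          refine integral_mono_of_nonneg
            (Eventually.of_forall fun xs => integral_nonneg fun a => (Real.exp_pos _).le) ?_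
            (Eventually.of_forall hinner)
          exact (Integrable.of_bound (by fun_prop) (Real.exp (|t| * (2 * C)))
            (Eventually.of_forall fun xs => hexp _ (hsub _ _ (hgb xs) heb))).const_mul _
      _ ≤ Real.exp (c ^ 2 * t ^ 2 / 2) * Real.exp (n * c ^ 2 * t ^ 2 / 2) := by
          rw [integral_const_mul]
          gcongr
          exact ih (fun j => m j.succ) g hgm hgb hgdiff
      _ = Real.exp ((n + 1 : ℕ) * c ^ 2 * t ^ 2 / 2) := by
          rw [← Real.exp_add]
          congr 1
          push_cast
          ring

/-- **McDiarmid's inequality** (with a non-optimal constant): a bounded function of `n` independent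
variables that changes by at most `c` when one variable changes is sub-Gaussian around its mean,
with parameter `n c²`. -/
theorem hasSubgaussianMGF_of_bounded_differences {E : Type*} [MeasurableSpace E] (c : ℝ≥0)
    {n : ℕ} (m : Fin n → Measure E) [∀ i, IsProbabilityMeasure (m i)] {f : (Fin n → E) → ℝ}
    (hf : Measurable f) {C : ℝ} (hb : ∀ x, |f x| ≤ C)
    (hdiff : ∀ x i y, |f (Function.update x i y) - f x| ≤ c) :
    HasSubgaussianMGF (fun x => f x - ∫ y, f y ∂(Measure.pi m)) (n * c ^ 2) (Measure.pi m) where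
  integrable_exp_mul t := by
    refine integrable_exp_mul_of_mem_Icc (a := -C - ∫ y, f y ∂(Measure.pi m))
      (b := C - ∫ y, f y ∂(Measure.pi m)) (by fun_prop) (Eventually.of_forall fun x => ?_)
    have := abs_le.mp (hb x)
    constructor <;> linarith
  mgf_le t := by
    have := integral_exp_le_of_bounded_differences c t n m f hf C hb hdiff
    simpa [mgf] using this

theorem measureReal_abs_sub_integral_ge_le {E : Type*} [MeasurableSpace E] (c : ℝ≥0)
    {n : ℕ} (m : Fin n → Measure E) [∀ i, IsProbabilityMeasure (m i)] {f : (Fin n → E) → ℝ}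
    (hf : Measurable f) {C : ℝ} (hb : ∀ x, |f x| ≤ C)
    (hdiff : ∀ x i y, |f (Function.update x i y) - f x| ≤ c) {ε : ℝ} (hε : 0 ≤ ε) :
    (Measure.pi m).real {x | ε ≤ |f x - ∫ y, f y ∂(Measure.pi m)|}
      ≤ 2 * Real.exp (-ε ^ 2 / (2 * (n * c ^ 2))) := by
  have h := hasSubgaussianMGF_of_bounded_differences c m hf hb hdiff
  have h1 := h.measure_ge_le hε
  have h2 := h.neg.measure_ge_le hε
  simp only [NNReal.coe_mul, NNReal.coe_pow, NNReal.coe_natCast] at h1 h2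
  calc _ ≤ (Measure.pi m).real ({x | ε ≤ f x - ∫ y, f y ∂(Measure.pi m)} ∪
        {x | ε ≤ (-fun x => f x - ∫ y, f y ∂(Measure.pi m)) x}) := by
        refine measureReal_mono fun x hx => ?_
        exact le_abs.mp (show ε ≤ |_| from hx)
    _ ≤ _ := measureReal_union_le _ _
    _ ≤ _ := by linarith

/-! ### Resolvents of Hermitian matrices and their perturbations -/

/-- The matrix `A` with its entries at `(i, j)` and `(j, i)` replaced by zero. -/
def eraseEntry {n : Type*} [DecidableEq n] (A : Matrix n n ℂ) (i j : n) : Matrix n n ℂ :=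
  Matrix.of fun a b => if (a = i ∧ b = j) ∨ (a = j ∧ b = i) then 0 else A a b

theorem isHermitian_eraseEntry {n : Type*} [DecidableEq n]
    {A : Matrix n n ℂ} (hA : A.IsHermitian) (i j : n) :
    (eraseEntry A i j).IsHermitian := by
  ext a b
  simp only [Matrix.conjTranspose_apply, eraseEntry, Matrix.of_apply]
  by_cases h : (b = i ∧ a = j) ∨ (b = j ∧ a = i)
  · rw [if_pos h, if_pos (by tauto), star_zero]
  · rw [if_neg h, if_neg (by tauto), hA.apply]

theorem sub_eraseEntry {n : Type*} [DecidableEq n] {A : Matrix n n ℂ} (hA : A.IsHermitian)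
    {i j : n} (hij : i ≠ j) :
    A - eraseEntry A i j
      = Matrix.single i j (A i j) + Matrix.single j i (star (A i j)) := by
  ext a b
  simp only [Matrix.sub_apply, eraseEntry, Matrix.of_apply, Matrix.add_apply, Matrix.single_apply]
  by_cases h1 : a = i ∧ b = j
  · obtain ⟨rfl, rfl⟩ := h1
    simp [hij]
  · by_cases h2 : a = j ∧ b = i
    · obtain ⟨rfl, rfl⟩ := h2
      simp [hij, hA.apply]
    · rw [if_neg (by tauto), if_neg (by tauto), if_neg (by tauto)]
      simp

section Resolvent

variable {n : Type*} [Fintype n] [DecidableEq n]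

/-- The resolvent `(A - z)⁻¹` of a square matrix (zero when `A - z` is singular). -/
noncomputable def matrixResolvent (A : Matrix n n ℂ) (z : ℂ) : Matrix n n ℂ :=
  (A - z • (1 : Matrix n n ℂ))⁻¹

theorem eigenvalue_sub_ne_zero {z : ℂ} (hz : z.im ≠ 0) (x : ℝ) : (x : ℂ) - z ≠ 0 := fun h =>
  hz (by simpa using congrArg Complex.im h)

theorem sub_smul_one_mul_diagonalization {A : Matrix n n ℂ} (hA : A.IsHermitian) {z : ℂ}
    (hz : z.im ≠ 0) :
    (A - z • (1 : Matrix n n ℂ)) * ((hA.eigenvectorUnitary : Matrix n n ℂ) *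
      Matrix.diagonal (fun i => ((hA.eigenvalues i : ℂ) - z)⁻¹) *
      star (hA.eigenvectorUnitary : Matrix n n ℂ)) = 1 := by
  set U : Matrix n n ℂ := (hA.eigenvectorUnitary : Matrix n n ℂ) with hU
  have hUU : U * star U = 1 := Unitary.mul_star_self_of_mem hA.eigenvectorUnitary.2
  have hUU' : star U * U = 1 := Unitary.star_mul_self_of_mem hA.eigenvectorUnitary.2
  have hspec : A = U * Matrix.diagonal (fun i => (hA.eigenvalues i : ℂ)) * star U := by
    have := hA.spectral_theorem
    rwa [Unitary.conjStarAlgAut_apply] at this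
  have hAz : A - z • (1 : Matrix n n ℂ)
      = U * Matrix.diagonal (fun i => (hA.eigenvalues i : ℂ) - z) * star U := by
    have : Matrix.diagonal (fun i => (hA.eigenvalues i : ℂ) - z)
        = Matrix.diagonal (fun i => (hA.eigenvalues i : ℂ)) - z • (1 : Matrix n n ℂ) := by
      rw [← Matrix.diagonal_one, ← Matrix.diagonal_smul, Matrix.diagonal_sub]
      simp
    rw [this, mul_sub, sub_mul, ← hspec, mul_smul_comm, mul_one, smul_mul_assoc, hUU]
  rw [hAz]
  calc _ = U * (Matrix.diagonal (fun i => (hA.eigenvalues i : ℂ) - z) * (star U * U) *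
      Matrix.diagonal (fun i => ((hA.eigenvalues i : ℂ) - z)⁻¹)) * star U := by
        simp only [mul_assoc]
    _ = 1 := by
        rw [hUU', mul_one, Matrix.diagonal_mul_diagonal]
        simp only [mul_inv_cancel₀ (eigenvalue_sub_ne_zero hz _)]
        rw [Matrix.diagonal_one, mul_one, hUU]

theorem matrixResolvent_eq {A : Matrix n n ℂ} (hA : A.IsHermitian) {z : ℂ} (hz : z.im ≠ 0) :
    matrixResolvent A z = (hA.eigenvectorUnitary : Matrix n n ℂ) *
      Matrix.diagonal (fun i => ((hA.eigenvalues i : ℂ) - z)⁻¹) *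
      star (hA.eigenvectorUnitary : Matrix n n ℂ) :=
  Matrix.inv_eq_right_inv (sub_smul_one_mul_diagonalization hA hz)

theorem sub_smul_one_mul_matrixResolvent {A : Matrix n n ℂ} (hA : A.IsHermitian) {z : ℂ}
    (hz : z.im ≠ 0) : (A - z • (1 : Matrix n n ℂ)) * matrixResolvent A z = 1 := by
  rw [matrixResolvent_eq hA hz, sub_smul_one_mul_diagonalization hA hz]

theorem matrixResolvent_mul_sub_smul_one {A : Matrix n n ℂ} (hA : A.IsHermitian) {z : ℂ}
    (hz : z.im ≠ 0) : matrixResolvent A z * (A - z • (1 : Matrix n n ℂ)) = 1 :=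
  mul_eq_one_comm.mp (sub_smul_one_mul_matrixResolvent hA hz)

theorem trace_matrixResolvent {A : Matrix n n ℂ} (hA : A.IsHermitian) {z : ℂ} (hz : z.im ≠ 0) :
    (matrixResolvent A z).trace = ∑ i, ((hA.eigenvalues i : ℂ) - z)⁻¹ := by
  rw [matrixResolvent_eq hA hz, Matrix.trace_mul_comm, ← mul_assoc,
    Unitary.star_mul_self_of_mem hA.eigenvectorUnitary.2, one_mul, Matrix.trace_diagonal]

theorem norm_inv_ofReal_sub_le {z : ℂ} (hz : z.im ≠ 0) (x : ℝ) :
    ‖((x : ℂ) - z)⁻¹‖ ≤ |z.im|⁻¹ := by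
  rw [norm_inv]
  refine inv_anti₀ (abs_pos.mpr hz) ?_
  simpa using Complex.abs_im_le_norm ((x : ℂ) - z)

theorem norm_matrixResolvent_le {A : Matrix n n ℂ} (hA : A.IsHermitian) {z : ℂ}
    (hz : z.im ≠ 0) : ‖matrixResolvent A z‖ ≤ |z.im|⁻¹ := by
  rw [matrixResolvent_eq hA hz, ← Unitary.coe_star, CStarRing.norm_mul_coe_unitary,
    CStarRing.norm_coe_unitary_mul, Matrix.l2_opNorm_diagonal, pi_norm_le_iff_of_nonneg
      (by positivity)]
  exact fun i => norm_inv_ofReal_sub_le hz _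

theorem sum_norm_sq_column_le (M : Matrix n n ℂ) (j : n) : ∑ i, ‖M i j‖ ^ 2 ≤ ‖M‖ ^ 2 := by
  have h := Matrix.l2_opNorm_mulVec M (EuclideanSpace.single j (1 : ℂ))
  rw [PiLp.norm_single, norm_one, mul_one, EuclideanSpace.norm_eq] at h
  rw [← Real.sqrt_le_left (norm_nonneg M)]
  refine le_trans (le_of_eq ?_) h
  congr 1
  refine Finset.sum_congr rfl fun i _ => ?_
  simp

theorem norm_entry_le_opNorm (M : Matrix n n ℂ) (i j : n) : ‖M i j‖ ≤ ‖M‖ := by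
  refine le_of_sq_le_sq ?_ (norm_nonneg M)
  exact (Finset.single_le_sum (f := fun i => ‖M i j‖ ^ 2) (fun _ _ => by positivity)
    (Finset.mem_univ i)).trans (sum_norm_sq_column_le M j)

theorem norm_matrixResolvent_entry_le {A : Matrix n n ℂ} (hA : A.IsHermitian) {z : ℂ}
    (hz : z.im ≠ 0) (i j : n) : ‖matrixResolvent A z i j‖ ≤ |z.im|⁻¹ :=
  (norm_entry_le_opNorm _ i j).trans (norm_matrixResolvent_le hA hz)

theorem norm_toEuclideanLin_apply_le (M : Matrix n n ℂ) (x : EuclideanSpace ℂ n) :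
    ‖Matrix.toEuclideanLin M x‖ ≤ ‖M‖ * ‖x‖ := Matrix.l2_opNorm_mulVec M x

/-- The trace is computed in an orthonormal basis of the range. -/
theorem norm_trace_le_rank_mul_norm (M : Matrix n n ℂ) : ‖M.trace‖ ≤ M.rank * ‖M‖ := by
  set T := Matrix.toEuclideanLin M with hT
  have hlin : T = Matrix.toLin (PiLp.basisFun 2 ℂ n) (PiLp.basisFun 2 ℂ n) M :=
    DFunLike.congr_fun (Matrix.toLpLin_eq_toLin 2 2) M
  have htr : LinearMap.trace ℂ _ T = M.trace := by
    rw [hlin, Matrix.trace_toLin_eq]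
  have hres := LinearMap.trace_restrict_eq_of_forall_mem (LinearMap.range T) T
    (fun x => LinearMap.mem_range_self T x)
  have hrank : M.rank = Module.finrank ℂ (LinearMap.range T) := by
    rw [hlin]
    exact Matrix.rank_eq_finrank_range_toLin M (PiLp.basisFun 2 ℂ n) (PiLp.basisFun 2 ℂ n)
  rw [← htr, ← hres, LinearMap.trace_eq_sum_inner _ (stdOrthonormalBasis ℂ (LinearMap.range T))]
  refine (norm_sum_le _ _).trans ((Finset.sum_le_card_nsmul _ _ ‖M‖ fun i _ => ?_).trans ?_)
  · refine (norm_inner_le_norm _ _).trans ?_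
    rw [OrthonormalBasis.norm_eq_one, one_mul]
    refine (norm_toEuclideanLin_apply_le M _).trans ?_
    rw [Submodule.subtype_apply, Submodule.norm_coe, OrthonormalBasis.norm_eq_one, mul_one]
  · simp [hrank]

theorem matrixResolvent_sub {A B : Matrix n n ℂ} (hA : A.IsHermitian) (hB : B.IsHermitian)
    {z : ℂ} (hz : z.im ≠ 0) :
    matrixResolvent A z - matrixResolvent B z
      = matrixResolvent A z * (B - A) * matrixResolvent B z := by
  have h : B - A = (B - z • (1 : Matrix n n ℂ)) - (A - z • (1 : Matrix n n ℂ)) := by abel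
  rw [h, mul_sub, sub_mul, mul_assoc, sub_smul_one_mul_matrixResolvent hB hz, mul_one,
    matrixResolvent_mul_sub_smul_one hA hz, one_mul]

theorem rank_le_two_of_eq_zero_off_cross {D : Matrix n n ℂ} {k : n}
    (h : ∀ i j, i ≠ k → j ≠ k → D i j = 0) : D.rank ≤ 2 := by
  have : D = (Matrix.of fun i (l : Fin 2) => if l = 0 then (if i = k then 1 else 0)
        else (if i = k then 0 else D i k)) *
      (Matrix.of fun (l : Fin 2) j => if l = 0 then D k j else (if j = k then 1 else 0)) := by
    ext i j
    simp only [Matrix.mul_apply, Fin.sum_univ_two, Matrix.of_apply]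
    by_cases hi : i = k
    · simp [hi]
    · by_cases hj : j = k
      · simp [hi, hj]
      · simp [hi, hj, h i j hi hj]
  rw [this]
  exact (Matrix.rank_mul_le_left _ _).trans ((Matrix.rank_le_card_width _).trans (by simp))

/-- Modifying one row and the corresponding column of a Hermitian matrix changes the trace of the
resolvent by a bounded amount, whatever the size of the modification: the difference of the
resolvents has rank at most two and norm at most `2 / |Im z|`. -/
theorem norm_trace_matrixResolvent_sub_le {A B : Matrix n n ℂ} (hA : A.IsHermitian)
    (hB : B.IsHermitian) {z : ℂ} (hz : z.im ≠ 0) {k : n}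
    (h : ∀ i j, i ≠ k → j ≠ k → A i j = B i j) :
    ‖(matrixResolvent A z).trace - (matrixResolvent B z).trace‖ ≤ 4 * |z.im|⁻¹ := by
  rw [← Matrix.trace_sub]
  have hrank : (matrixResolvent A z - matrixResolvent B z).rank ≤ 2 := by
    rw [matrixResolvent_sub hA hB hz]
    refine (Matrix.rank_mul_le_left _ _).trans ((Matrix.rank_mul_le_right _ _).trans ?_)
    exact rank_le_two_of_eq_zero_off_cross (k := k) fun i j hi hj => by
      simp [h i j hi hj]
  have hnorm : ‖matrixResolvent A z - matrixResolvent B z‖ ≤ 2 * |z.im|⁻¹ :=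
    (norm_sub_le _ _).trans (by
      linarith [norm_matrixResolvent_le hA hz, norm_matrixResolvent_le hB hz])
  calc _ ≤ ((matrixResolvent A z - matrixResolvent B z).rank : ℝ) *
        ‖matrixResolvent A z - matrixResolvent B z‖ := norm_trace_le_rank_mul_norm _
    _ ≤ 2 * (2 * |z.im|⁻¹) := by
        gcongr
        exact_mod_cast hrank
    _ = _ := by ring

theorem mul_single_mul_apply (M K : Matrix n n ℂ) (i j a b : n) (v : ℂ) :
    (M * Matrix.single i j v * K) a b = v * M a i * K j b := by
  rw [Matrix.mul_apply, Finset.sum_eq_single j]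
  · rw [Matrix.mul_single_apply_same]; ring
  · intro c _ hc
    rw [Matrix.mul_single_apply_of_ne _ _ _ _ _ hc, zero_mul]
  · simp

/-- First order resolvent expansion in one off-diagonal entry. -/
theorem matrixResolvent_apply_sub_eraseEntry {A : Matrix n n ℂ} (hA : A.IsHermitian) {z : ℂ}
    (hz : z.im ≠ 0) {i j : n} (hij : i ≠ j) (a b : n) :
    matrixResolvent A z a b - matrixResolvent (eraseEntry A i j) z a b
      = -(A i j * matrixResolvent (eraseEntry A i j) z a i * matrixResolvent A z j b
        + star (A i j) * matrixResolvent (eraseEntry A i j) z a j * matrixResolvent A z i b) := by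
  have h := congrFun (congrFun (matrixResolvent_sub (isHermitian_eraseEntry hA i j) hA hz) a) b
  rw [sub_eraseEntry hA hij, mul_add, add_mul, Matrix.add_apply, mul_single_mul_apply,
    mul_single_mul_apply, Matrix.sub_apply] at h
  rw [← h]
  ring

theorem norm_matrixResolvent_apply_sub_eraseEntry_le {A : Matrix n n ℂ} (hA : A.IsHermitian)
    {z : ℂ} (hz : z.im ≠ 0) {i j : n} (hij : i ≠ j) (a b : n) :
    ‖matrixResolvent A z a b - matrixResolvent (eraseEntry A i j) z a b‖
      ≤ 2 * |z.im|⁻¹ ^ 2 * ‖A i j‖ := by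
  have hG := norm_matrixResolvent_entry_le hA hz
  have hG0 := norm_matrixResolvent_entry_le (isHermitian_eraseEntry hA i j) hz
  rw [matrixResolvent_apply_sub_eraseEntry hA hz hij, norm_neg]
  refine (norm_add_le _ _).trans ?_
  rw [norm_mul, norm_mul, norm_mul, norm_mul, norm_star]
  calc _ ≤ ‖A i j‖ * |z.im|⁻¹ * |z.im|⁻¹ + ‖A i j‖ * |z.im|⁻¹ * |z.im|⁻¹ := by
        gcongr <;> first | exact hG _ _ | exact hG0 _ _
    _ = _ := by ring

/-- Second order resolvent expansion in one off-diagonal entry `A i j`. The remainder is bounded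
both by the entry and by its square, so that only second moments are needed to average it. -/
theorem norm_entry_mul_matrixResolvent_expansion_le {A : Matrix n n ℂ} (hA : A.IsHermitian)
    {z : ℂ} (hz : z.im ≠ 0) {i j : n} (hij : i ≠ j) :
    ‖A i j * matrixResolvent A z j i
        - (A i j * matrixResolvent (eraseEntry A i j) z j i
          - A i j ^ 2 * matrixResolvent (eraseEntry A i j) z j i ^ 2
          - (‖A i j‖ ^ 2 : ℝ) * (matrixResolvent (eraseEntry A i j) z i i
              * matrixResolvent (eraseEntry A i j) z j j))‖
      ≤ 4 * |z.im|⁻¹ ^ 2 * (‖A i j‖ ^ 2 * min (|z.im|⁻¹ * ‖A i j‖) 1) := by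
  set v := A i j with hv
  set κ := |z.im|⁻¹ with hκ
  set G := matrixResolvent A z with hGdef
  set G0 := matrixResolvent (eraseEntry A i j) z with hG0def
  have hκ0 : 0 ≤ κ := by positivity
  have hG : ∀ a b, ‖G a b‖ ≤ κ := norm_matrixResolvent_entry_le hA hz
  have hG0 : ∀ a b, ‖G0 a b‖ ≤ κ :=
    norm_matrixResolvent_entry_le (isHermitian_eraseEntry hA i j) hz
  have hexp : G j i - G0 j i = -(v * G0 j i * G j i + star v * G0 j j * G i i) :=
    matrixResolvent_apply_sub_eraseEntry hA hz hij j i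
  have hvv : ((‖v‖ ^ 2 : ℝ) : ℂ) = v * star v := by
    rw [Complex.star_def, Complex.mul_conj, Complex.normSq_eq_norm_sq]
  have hd : ∀ a b, ‖G a b - G0 a b‖ ≤ 2 * κ * min (κ * ‖v‖) 1 := by
    intro a b
    rw [mul_min_of_nonneg _ _ (by positivity), le_min_iff]
    constructor
    · refine (norm_matrixResolvent_apply_sub_eraseEntry_le hA hz hij a b).trans (le_of_eq ?_)
      rw [← hκ, ← hv]; ring
    · exact (norm_sub_le _ _).trans (by linarith [hG a b, hG0 a b])
  have hkey : v * G j i - (v * G0 j i - v ^ 2 * G0 j i ^ 2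
      - (‖v‖ ^ 2 : ℝ) * (G0 i i * G0 j j))
      = -(v * (v * G0 j i * (G j i - G0 j i) + star v * G0 j j * (G i i - G0 i i))) := by
    rw [hvv]
    linear_combination v * hexp
  rw [hkey, norm_neg, norm_mul]
  have hmin : 0 ≤ min (κ * ‖v‖) 1 := by positivity
  have h2 : ‖v * G0 j i * (G j i - G0 j i) + star v * G0 j j * (G i i - G0 i i)‖
      ≤ ‖v‖ * κ * (2 * κ * min (κ * ‖v‖) 1) + ‖v‖ * κ * (2 * κ * min (κ * ‖v‖) 1) := by
    refine (norm_add_le _ _).trans ?_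
    rw [norm_mul, norm_mul, norm_mul, norm_mul, norm_star]
    gcongr <;> first | exact hd _ _ | exact hG0 _ _
  calc _ ≤ ‖v‖ * (‖v‖ * κ * (2 * κ * min (κ * ‖v‖) 1) + ‖v‖ * κ * (2 * κ * min (κ * ‖v‖) 1)) := by
        gcongr
    _ = _ := by ring

/-- The trace of the identity `A (A - z)⁻¹ = 1 + z (A - z)⁻¹`. -/
theorem sum_mul_matrixResolvent {A : Matrix n n ℂ} (hA : A.IsHermitian) {z : ℂ}
    (hz : z.im ≠ 0) :
    ∑ i, ∑ j, A i j * matrixResolvent A z j i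
      = Fintype.card n + z * (matrixResolvent A z).trace := by
  have h := congrArg Matrix.trace (sub_smul_one_mul_matrixResolvent hA hz)
  rw [sub_mul, smul_mul_assoc, one_mul, Matrix.trace_sub, Matrix.trace_smul, Matrix.trace_one,
    smul_eq_mul, sub_eq_iff_eq_add] at h
  rw [← h, Matrix.trace]
  simp only [Matrix.diag_apply, Matrix.mul_apply]

end Resolvent

/-! ### Averaging the resolvent expansion over one entry -/

section RandomResolvent

variable {Ω : Type*} [MeasurableSpace Ω] {P : Measure Ω} {n : Type*} [Fintype n] [DecidableEq n]

theorem measurable_matrixResolvent_apply (z : ℂ) (a b : n) :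
    Measurable fun M : n → n → ℂ => matrixResolvent (Matrix.of M) z a b := by
  have hc : Continuous fun M : n → n → ℂ => Matrix.of M - z • (1 : Matrix n n ℂ) :=
    Continuous.sub (continuous_id (X := n → n → ℂ)) continuous_const
  have h1 : Measurable fun M : n → n → ℂ => ((Matrix.of M - z • (1 : Matrix n n ℂ)).det)⁻¹ :=
    hc.matrix_det.measurable.inv
  have h2 : Measurable fun M : n → n → ℂ => (Matrix.of M - z • (1 : Matrix n n ℂ)).adjugate a b :=
    (hc.matrix_adjugate.matrix_elem a b).measurable
  have h3 : (fun M : n → n → ℂ => matrixResolvent (Matrix.of M) z a b)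
      = fun M => ((Matrix.of M - z • (1 : Matrix n n ℂ)).det)⁻¹ *
        (Matrix.of M - z • (1 : Matrix n n ℂ)).adjugate a b := by
    ext M
    rw [matrixResolvent, Matrix.inv_def, Ring.inverse_eq_inv', Matrix.smul_apply, smul_eq_mul]
  rw [h3]
  exact h1.mul h2

theorem aemeasurable_matrixResolvent_apply {A : Ω → Matrix n n ℂ}
    (hmeas : ∀ a b, AEMeasurable (fun ω => A ω a b) P) (z : ℂ) (a b : n) :
    AEMeasurable (fun ω => matrixResolvent (A ω) z a b) P :=
  (measurable_matrixResolvent_apply z a b).comp_aemeasurable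
    (f := fun ω a b => A ω a b)
    (aemeasurable_pi_lambda _ fun a => aemeasurable_pi_lambda _ fun b => hmeas a b)

theorem aemeasurable_eraseEntry_apply {n : Type*} [DecidableEq n] {A : Ω → Matrix n n ℂ}
    (hmeas : ∀ a b, AEMeasurable (fun ω => A ω a b) P) (i j a b : n) :
    AEMeasurable (fun ω => eraseEntry (A ω) i j a b) P := by
  by_cases h : (a = i ∧ b = j) ∨ (a = j ∧ b = i)
  · simp [eraseEntry, h]
  · simpa [eraseEntry, h] using hmeas a b

/-- Averaging the second order expansion in the entry `A i j`, which is centered and independent of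
the other entries: `N A i j G j i` has the mean of `- G i i G j j`, up to small errors. -/
theorem norm_integral_entry_mul_matrixResolvent_le [IsProbabilityMeasure P] {A : Ω → Matrix n n ℂ}
    (hA : ∀ ω, (A ω).IsHermitian) (hmeas : ∀ a b, AEMeasurable (fun ω => A ω a b) P) {z : ℂ}
    (hz : z.im ≠ 0) {i j : n} (hij : i ≠ j)
    (hindep : IndepFun (fun ω => A ω i j) (fun ω a b => eraseEntry (A ω) i j a b) P)
    (hmean : ∫ ω, A ω i j ∂P = 0) (hL2 : MemLp (fun ω => A ω i j) 2 P) {N : ℝ} (hN : 0 < N)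
    (hvar : ∫ ω, ‖A ω i j‖ ^ 2 ∂P = 1 / N) :
    ‖∫ ω, ((N : ℂ) * (A ω i j * matrixResolvent (A ω) z j i)
        + matrixResolvent (A ω) z i i * matrixResolvent (A ω) z j j) ∂P‖
      ≤ ∫ ω, ‖matrixResolvent (A ω) z j i‖ ^ 2 ∂P + 8 * |z.im|⁻¹ ^ 3 * ∫ ω, ‖A ω i j‖ ∂P
        + 4 * |z.im|⁻¹ ^ 2 *
          (N * ∫ ω, ‖A ω i j‖ ^ 2 * min (|z.im|⁻¹ * ‖A ω i j‖) 1 ∂P) := by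
  set κ := |z.im|⁻¹ with hκ
  have hκ0 : 0 ≤ κ := by positivity
  set v : Ω → ℂ := fun ω => A ω i j with hv
  set G : Ω → n → n → ℂ := fun ω => matrixResolvent (A ω) z with hGdef
  set G0 : Ω → n → n → ℂ := fun ω => matrixResolvent (eraseEntry (A ω) i j) z with hG0def
  have hA0 : ∀ ω, (eraseEntry (A ω) i j).IsHermitian := fun ω => isHermitian_eraseEntry (hA ω) i j
  have hG : ∀ ω a b, ‖G ω a b‖ ≤ κ := fun ω => norm_matrixResolvent_entry_le (hA ω) hz
  have hG0 : ∀ ω a b, ‖G0 ω a b‖ ≤ κ := fun ω => norm_matrixResolvent_entry_le (hA0 ω) hz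
  have hGm : ∀ a b, AEStronglyMeasurable (fun ω => G ω a b) P := fun a b =>
    (aemeasurable_matrixResolvent_apply hmeas z a b).aestronglyMeasurable
  have hm0 := aemeasurable_eraseEntry_apply hmeas i j
  have hG0m : ∀ a b, AEStronglyMeasurable (fun ω => G0 ω a b) P := fun a b =>
    (aemeasurable_matrixResolvent_apply hm0 z a b).aestronglyMeasurable
  have hd : ∀ ω a b, ‖G ω a b - G0 ω a b‖ ≤ 2 * κ ^ 2 * ‖v ω‖ := fun ω a b =>
    norm_matrixResolvent_apply_sub_eraseEntry_le (hA ω) hz hij a b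
  have hvm : AEStronglyMeasurable v P := hL2.aestronglyMeasurable
  have hvi : Integrable v P := hL2.integrable (by norm_num)
  have hv2 : Integrable (fun ω => ‖v ω‖ ^ 2) P := hL2.integrable_norm_pow (by norm_num)
  have hv2' : Integrable (fun ω => v ω ^ 2) P :=
    hv2.mono (by fun_prop) (Eventually.of_forall fun ω => by simp)
  have hv2c : Integrable (fun ω => ((‖v ω‖ ^ 2 : ℝ) : ℂ)) P := hv2.ofReal
  -- products of the entry with functions of the other entries
  have hprod : ∀ (φ : ℂ → ℂ) (ψ : (n → n → ℂ) → ℂ), Measurable φ → Measurable ψ →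
      ∫ ω, φ (v ω) * ψ (fun a b => eraseEntry (A ω) i j a b) ∂P
        = (∫ ω, φ (v ω) ∂P) * ∫ ω, ψ (fun a b => eraseEntry (A ω) i j a b) ∂P := by
    intro φ ψ hφ hψ
    exact hindep.integral_fun_comp_mul_comp (hmeas i j)
      (aemeasurable_pi_lambda _ fun a => aemeasurable_pi_lambda _ fun b => hm0 a b)
      hφ.aestronglyMeasurable hψ.aestronglyMeasurable
  have hR := measurable_matrixResolvent_apply (n := n) z
  have e1 : ∫ ω, v ω * G0 ω j i ∂P = 0 := by
    have := hprod (fun x => x) (fun M => matrixResolvent (Matrix.of M) z j i) measurable_id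
      (hR j i)
    rw [show ∫ ω, (fun x => x) (v ω) ∂P = 0 from hmean, zero_mul] at this
    exact this
  have e2 : ∫ ω, v ω ^ 2 * G0 ω j i ^ 2 ∂P = (∫ ω, v ω ^ 2 ∂P) * ∫ ω, G0 ω j i ^ 2 ∂P :=
    hprod (fun x => x ^ 2) (fun M => matrixResolvent (Matrix.of M) z j i ^ 2) (by fun_prop)
      ((hR j i).pow_const 2)
  have e3 : ∫ ω, ((‖v ω‖ ^ 2 : ℝ) : ℂ) * (G0 ω i i * G0 ω j j) ∂P
      = (1 / N : ℂ) * ∫ ω, G0 ω i i * G0 ω j j ∂P := by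
    have := hprod (fun x => ((‖x‖ ^ 2 : ℝ) : ℂ)) (fun M => matrixResolvent (Matrix.of M) z i i
      * matrixResolvent (Matrix.of M) z j j) (by fun_prop) ((hR i i).mul (hR j j))
    rw [show ∫ ω, (fun x => ((‖x‖ ^ 2 : ℝ) : ℂ)) (v ω) ∂P = (1 / N : ℂ) by
      have h := integral_ofReal (𝕜 := ℂ) (μ := P) (f := fun ω => ‖v ω‖ ^ 2)
      rw [hvar] at h
      simpa using h] at this
    exact this
  -- integrability of the terms of the expansion
  have i0 : Integrable (fun ω => v ω * G ω j i) P :=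
    hvi.mul_bdd (c := κ) (hGm j i) (Eventually.of_forall fun ω => hG ω j i)
  have i1 : Integrable (fun ω => v ω * G0 ω j i) P :=
    hvi.mul_bdd (c := κ) (hG0m j i) (Eventually.of_forall fun ω => hG0 ω j i)
  have b2 : ∀ ω, ‖G0 ω j i ^ 2‖ ≤ κ ^ 2 := fun ω => by
    rw [norm_pow]; gcongr; exact hG0 ω j i
  have b3 : ∀ ω, ‖G0 ω i i * G0 ω j j‖ ≤ κ * κ := fun ω => by
    rw [norm_mul]; gcongr <;> exact hG0 ω _ _
  have b4 : ∀ ω, ‖G ω i i * G ω j j‖ ≤ κ * κ := fun ω => by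
    rw [norm_mul]; gcongr <;> exact hG ω _ _
  have i2 : Integrable (fun ω => v ω ^ 2 * G0 ω j i ^ 2) P :=
    hv2'.mul_bdd (c := κ ^ 2) ((hG0m j i).pow 2) (Eventually.of_forall b2)
  have i3 : Integrable (fun ω => ((‖v ω‖ ^ 2 : ℝ) : ℂ) * (G0 ω i i * G0 ω j j)) P :=
    hv2c.mul_bdd (c := κ * κ) ((hG0m i i).mul (hG0m j j)) (Eventually.of_forall b3)
  have i4 : Integrable (fun ω => G0 ω i i * G0 ω j j) P :=
    Integrable.of_bound ((hG0m i i).mul (hG0m j j)) (κ * κ) (Eventually.of_forall b3)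
  have i5 : Integrable (fun ω => G ω i i * G ω j j) P :=
    Integrable.of_bound ((hGm i i).mul (hGm j j)) (κ * κ) (Eventually.of_forall b4)
  have i6 : Integrable (fun ω => ‖v ω‖ ^ 2 * min (κ * ‖v ω‖) 1) P := by
    refine hv2.mul_bdd (c := 1) (by fun_prop) (Eventually.of_forall fun ω => ?_)
    rw [Real.norm_eq_abs, abs_of_nonneg (by positivity)]
    exact min_le_right _ _
  have i7 : Integrable (fun ω => ‖G ω j i‖ ^ 2) P := by
    refine Integrable.of_bound ((hGm j i).norm.pow 2) (κ ^ 2) (Eventually.of_forall fun ω => ?_)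
    rw [norm_pow, norm_norm]; gcongr; exact hG ω j i
  set D : Ω → ℂ := fun ω => v ω * G ω j i - (v ω * G0 ω j i - v ω ^ 2 * G0 ω j i ^ 2
    - ((‖v ω‖ ^ 2 : ℝ) : ℂ) * (G0 ω i i * G0 ω j j)) with hD
  have hDb : ∀ ω, ‖D ω‖ ≤ 4 * κ ^ 2 * (‖v ω‖ ^ 2 * min (κ * ‖v ω‖) 1) := fun ω =>
    norm_entry_mul_matrixResolvent_expansion_le (hA ω) hz hij
  have hDint : ∫ ω, D ω ∂P = ∫ ω, v ω * G ω j i ∂P + (∫ ω, v ω ^ 2 ∂P) * ∫ ω, G0 ω j i ^ 2 ∂P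
      + (1 / N : ℂ) * ∫ ω, G0 ω i i * G0 ω j j ∂P := by
    have i12 : Integrable (fun ω => v ω * G0 ω j i - v ω ^ 2 * G0 ω j i ^ 2) P := i1.sub i2
    have i123 : Integrable (fun ω => v ω * G0 ω j i - v ω ^ 2 * G0 ω j i ^ 2
      - ((‖v ω‖ ^ 2 : ℝ) : ℂ) * (G0 ω i i * G0 ω j j)) P := i12.sub i3
    rw [hD, integral_sub i0 i123, integral_sub i12 i3, integral_sub i1 i2, e1, e2, e3]
    ring
  have hNc : (N : ℂ) ≠ 0 := by exact_mod_cast hN.ne'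
  have hmain : ∫ ω, ((N : ℂ) * (v ω * G ω j i) + G ω i i * G ω j j) ∂P
      = N * ∫ ω, D ω ∂P - (N * ∫ ω, v ω ^ 2 ∂P) * ∫ ω, G0 ω j i ^ 2 ∂P
        + ∫ ω, (G ω i i * G ω j j - G0 ω i i * G0 ω j j) ∂P := by
    rw [integral_add (i0.const_mul _) i5, integral_const_mul, integral_sub i5 i4, hDint]
    field_simp
    ring
  -- the three error terms
  have t1 : ‖(N : ℂ) * ∫ ω, D ω ∂P‖
      ≤ 4 * κ ^ 2 * (N * ∫ ω, ‖v ω‖ ^ 2 * min (κ * ‖v ω‖) 1 ∂P) := by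
    rw [norm_mul, Complex.norm_real, Real.norm_eq_abs, abs_of_pos hN]
    calc _ ≤ N * ∫ ω, 4 * κ ^ 2 * (‖v ω‖ ^ 2 * min (κ * ‖v ω‖) 1) ∂P := by
          gcongr
          exact norm_integral_le_of_norm_le (i6.const_mul _) (Eventually.of_forall hDb)
      _ = _ := by rw [integral_const_mul]; ring
  have hvsq : ‖(N : ℂ) * ∫ ω, v ω ^ 2 ∂P‖ ≤ 1 := by
    rw [norm_mul, Complex.norm_real, Real.norm_eq_abs, abs_of_pos hN]
    calc _ ≤ N * ∫ ω, ‖v ω‖ ^ 2 ∂P := by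
          gcongr
          exact norm_integral_le_of_norm_le hv2 (Eventually.of_forall fun ω => by rw [norm_pow])
      _ = 1 := by rw [hvar]; field_simp
  have t2 : ‖((N : ℂ) * ∫ ω, v ω ^ 2 ∂P) * ∫ ω, G0 ω j i ^ 2 ∂P‖
      ≤ ∫ ω, ‖G ω j i‖ ^ 2 ∂P + 4 * κ ^ 3 * ∫ ω, ‖v ω‖ ∂P := by
    rw [norm_mul]
    calc _ ≤ 1 * ∫ ω, (‖G ω j i‖ ^ 2 + 4 * κ ^ 3 * ‖v ω‖) ∂P := by
          gcongr
          refine norm_integral_le_of_norm_le (i7.add (hvi.norm.const_mul _))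
            (Eventually.of_forall fun ω => ?_)
          have h1 : ‖G0 ω j i‖ ≤ ‖G ω j i‖ + ‖G ω j i - G0 ω j i‖ := norm_le_norm_add_norm_sub _ _
          have h2 := hd ω j i
          have h3 := hG ω j i
          have h4 := hG0 ω j i
          have h5 := norm_nonneg (G0 ω j i)
          have h6 := norm_nonneg (G ω j i)
          rw [norm_pow]
          have h7 : ‖G0 ω j i‖ ^ 2 - ‖G ω j i‖ ^ 2
              ≤ (2 * κ ^ 2 * ‖v ω‖) * (κ + κ) := by
            rw [sq_sub_sq, mul_comm]
            exact mul_le_mul (by linarith) (by linarith) (by linarith) (by positivity)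
          nlinarith
      _ = _ := by
          rw [one_mul, integral_add i7 (hvi.norm.const_mul _), integral_const_mul]
  have t3 : ‖∫ ω, (G ω i i * G ω j j - G0 ω i i * G0 ω j j) ∂P‖
      ≤ 4 * κ ^ 3 * ∫ ω, ‖v ω‖ ∂P := by
    rw [← integral_const_mul]
    refine norm_integral_le_of_norm_le (hvi.norm.const_mul _) (Eventually.of_forall fun ω => ?_)
    have : G ω i i * G ω j j - G0 ω i i * G0 ω j j
        = (G ω i i - G0 ω i i) * G ω j j + G0 ω i i * (G ω j j - G0 ω j j) := by ring
    rw [this]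
    refine (norm_add_le _ _).trans ?_
    rw [norm_mul, norm_mul]
    calc _ ≤ (2 * κ ^ 2 * ‖v ω‖) * κ + κ * (2 * κ ^ 2 * ‖v ω‖) := by
          gcongr
          exacts [hd ω _ _, hG ω _ _, hG0 ω _ _, hd ω _ _]
      _ = _ := by ring
  change ‖∫ ω, ((N : ℂ) * (v ω * G ω j i) + G ω i i * G ω j j) ∂P‖ ≤ _
  rw [hmain]
  refine (norm_add_le _ _).trans ((add_le_add_left (norm_sub_le _ _) _).trans ?_)
  change _ ≤ ∫ ω, ‖G ω j i‖ ^ 2 ∂P + 8 * κ ^ 3 * ∫ ω, ‖v ω‖ ∂P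
    + 4 * κ ^ 2 * (N * ∫ ω, ‖v ω‖ ^ 2 * min (κ * ‖v ω‖) 1 ∂P)
  linarith

end RandomResolvent

/-! ### The self-consistent equation for Wigner matrices -/

theorem eraseEntry_comm {n : Type*} [DecidableEq n] (A : Matrix n n ℂ) (i j : n) :
    eraseEntry A j i = eraseEntry A i j := by
  ext a b
  simp only [eraseEntry, Matrix.of_apply, or_comm]

theorem normalizedWigner_apply {N : ℕ} (X : Matrix (Fin N) (Fin N) ℂ) (a b : Fin N) :
    normalizedWigner X a b = ((1 / Real.sqrt N : ℝ) : ℂ) * X a b := rfl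

theorem isHermitian_normalizedWigner {N : ℕ} {X : Matrix (Fin N) (Fin N) ℂ}
    (hX : X.IsHermitian) : (normalizedWigner X).IsHermitian :=
  isHermitian_ofReal_smul hX _

theorem eraseEntry_normalizedWigner {N : ℕ} (X : Matrix (Fin N) (Fin N) ℂ) (i j : Fin N) :
    eraseEntry (normalizedWigner X) i j = normalizedWigner (eraseEntry X i j) := by
  ext a b
  simp only [eraseEntry, Matrix.of_apply, normalizedWigner_apply, mul_ite, mul_zero]

/-- The Stieltjes transform of the empirical spectral measure, up to the sign convention: the
normalized trace of the resolvent. -/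
noncomputable def empiricalStieltjes {N : ℕ} (A : Matrix (Fin N) (Fin N) ℂ) (z : ℂ) : ℂ :=
  1 / (N : ℂ) * (matrixResolvent A z).trace

theorem norm_empiricalStieltjes_le {N : ℕ} {A : Matrix (Fin N) (Fin N) ℂ} (hA : A.IsHermitian)
    {z : ℂ} (hz : z.im ≠ 0) : ‖empiricalStieltjes A z‖ ≤ |z.im|⁻¹ := by
  rcases Nat.eq_zero_or_pos N with rfl | hN
  · simp [empiricalStieltjes]
  have hN' : (0 : ℝ) < N := by exact_mod_cast hN
  rw [empiricalStieltjes, norm_mul, norm_div, norm_one, Complex.norm_natCast, one_div,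
    inv_mul_le_iff₀ hN', Matrix.trace]
  refine (norm_sum_le_of_le _ fun i _ => norm_matrixResolvent_entry_le hA hz i i).trans ?_
  simp

theorem im_empiricalStieltjes_mul_im_nonneg {N : ℕ} {A : Matrix (Fin N) (Fin N) ℂ}
    (hA : A.IsHermitian) {z : ℂ} (hz : z.im ≠ 0) : 0 ≤ (empiricalStieltjes A z).im * z.im := by
  have h : empiricalStieltjes A z = ((1 / (N : ℝ) : ℝ) : ℂ) * ∑ i,
      ((hA.eigenvalues i : ℂ) - z)⁻¹ := by
    rw [empiricalStieltjes, trace_matrixResolvent hA hz]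
    push_cast
    rfl
  rw [h, Complex.im_ofReal_mul, Complex.im_sum, mul_assoc, Finset.sum_mul]
  refine mul_nonneg (by positivity) (Finset.sum_nonneg fun i _ => ?_)
  rw [Complex.inv_im]
  simp only [Complex.sub_im, Complex.ofReal_im, zero_sub, neg_neg]
  rw [div_mul_eq_mul_div]
  exact div_nonneg (mul_self_nonneg _) (Complex.normSq_nonneg _)

namespace IsWignerMatrix

variable {Ω : Type*} [MeasurableSpace Ω] {P : Measure Ω} {μ : Measure ℂ} {ν : Measure ℝ} {N : ℕ}
  {X : Ω → Matrix (Fin N) (Fin N) ℂ}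

theorem apply_symm (hX : IsWignerMatrix P μ ν X) (i j : Fin N) :
    (fun ω => X ω i j) = fun ω => star (X ω j i) :=
  funext fun ω => ((hX.isHermitian ω).apply i j).symm

theorem apply_self (hX : IsWignerMatrix P μ ν X) (i : Fin N) :
    (fun ω => X ω i i) = fun ω => (((X ω i i).re : ℝ) : ℂ) :=
  funext fun ω => ((hX.isHermitian ω).coe_re_apply_self i).symm

theorem aemeasurable_apply (hX : IsWignerMatrix P μ ν X) (i j : Fin N) :
    AEMeasurable (fun ω => X ω i j) P := by
  rcases lt_trichotomy i j with h | rfl | h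
  · exact (hX.law_offDiag i j h).aemeasurable
  · rw [hX.apply_self i]
    exact Complex.measurable_ofReal.comp_aemeasurable (hX.law_diag i).aemeasurable
  · rw [hX.apply_symm i j]
    exact continuous_star.measurable.comp_aemeasurable (hX.law_offDiag j i h).aemeasurable

theorem memLp_apply (hX : IsWignerMatrix P μ ν X) {i j : Fin N} (hij : i ≠ j) :
    MemLp (fun ω => X ω i j) 2 P := by
  have key : ∀ i j : Fin N, i < j → MemLp (fun ω => X ω i j) 2 P := fun i j h => by
    have h1 := hX.law_offDiag i j h
    have h2 := hX.memLp_offDiag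
    rw [← h1.map_eq] at h2
    exact h2.comp_of_map h1.aemeasurable
  rcases lt_or_gt_of_ne hij with h | h
  · exact key i j h
  · rw [hX.apply_symm i j]
    exact (key j i h).star

theorem integral_apply (hX : IsWignerMatrix P μ ν X) {i j : Fin N} (hij : i ≠ j) :
    ∫ ω, X ω i j ∂P = 0 := by
  have key : ∀ i j : Fin N, i < j → ∫ ω, X ω i j ∂P = 0 := fun i j h => by
    rw [← hX.mean_offDiag]
    exact (hX.law_offDiag i j h).integral_eq
  rcases lt_or_gt_of_ne hij with h | h
  · exact key i j h
  · have h1 := integral_conj (𝕜 := ℂ) (μ := P) (f := fun ω => X ω j i)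
    rw [key j i h, map_zero] at h1
    rw [hX.apply_symm i j]
    exact h1

theorem integral_comp_norm_apply (hX : IsWignerMatrix P μ ν X) {i j : Fin N} (hij : i ≠ j)
    {φ : ℝ → ℝ} (hφ : Measurable φ) :
    ∫ ω, φ ‖X ω i j‖ ∂P = ∫ x, φ ‖x‖ ∂μ := by
  have key : ∀ i j : Fin N, i < j → ∫ ω, φ ‖X ω i j‖ ∂P = ∫ x, φ ‖x‖ ∂μ := fun i j h =>
    (hX.law_offDiag i j h).integral_comp (f := fun x => φ ‖x‖)
      (hφ.comp measurable_norm).aestronglyMeasurable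
  rcases lt_or_gt_of_ne hij with h | h
  · exact key i j h
  · rw [← key j i h]
    refine integral_congr_ae (Eventually.of_forall fun ω => ?_)
    have : X ω i j = star (X ω j i) := congrFun (hX.apply_symm i j) ω
    simp only [this, norm_star]

theorem integral_norm_apply_self (hX : IsWignerMatrix P μ ν X) (i : Fin N) :
    ∫ ω, ‖X ω i i‖ ∂P = ∫ x, |x| ∂ν := by
  have h := (hX.law_diag i).integral_comp (f := fun x : ℝ => |x|)
    (by fun_prop)
  rw [← h]
  refine integral_congr_ae (Eventually.of_forall fun ω => ?_)
  have : X ω i i = (((X ω i i).re : ℝ) : ℂ) := congrFun (hX.apply_self i) ω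
  simp only [Function.comp_apply]
  rw [this, Complex.norm_real, Real.norm_eq_abs, Complex.ofReal_re]

theorem integrable_apply_self [IsFiniteMeasure P] (hX : IsWignerMatrix P μ ν X) (i : Fin N) :
    Integrable (fun ω => X ω i i) P := by
  have h1 := hX.law_diag i
  have h2 := hX.memLp_diag
  rw [← h1.map_eq] at h2
  rw [hX.apply_self i]
  exact ((h2.comp_of_map h1.aemeasurable).integrable (by norm_num)).ofReal

/-- An off-diagonal entry is independent of the matrix in which this entry and its mirror image
are erased. -/
theorem indepFun_eraseEntry (hX : IsWignerMatrix P μ ν X) {i j : Fin N} (hij : i ≠ j) :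
    IndepFun (fun ω => X ω i j) (fun ω a b => eraseEntry (X ω) i j a b) P := by
  have key : ∀ i j : Fin N, i < j →
      IndepFun (fun ω => X ω i j) (fun ω a b => eraseEntry (X ω) i j a b) P := by
    intro i j h
    classical
    set p : {p : Fin N × Fin N // p.1 ≤ p.2} := ⟨(i, j), h.le⟩ with hp
    have hind := hX.indep.indepFun_finset₀ {p} (Finset.univ.erase p)
      (by simp) (fun q => hX.aemeasurable_apply _ _)
    -- the erased matrix, as a function of the entries at the positions other than `p`
    set φ : ({q // q ∈ Finset.univ.erase p} → ℂ) → Fin N → Fin N → ℂ := fun y a b =>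
      if hab : a ≤ b then
        if hq : (⟨(a, b), hab⟩ : {p : Fin N × Fin N // p.1 ≤ p.2}) ∈ Finset.univ.erase p
          then y ⟨_, hq⟩ else 0
      else if hq : (⟨(b, a), (not_le.mp hab).le⟩ : {p : Fin N × Fin N // p.1 ≤ p.2})
          ∈ Finset.univ.erase p then star (y ⟨_, hq⟩) else 0 with hφ
    have hφm : Measurable φ := by
      refine measurable_pi_lambda _ fun a => measurable_pi_lambda _ fun b => ?_
      simp only [hφ]
      split_ifs
      · exact measurable_pi_apply _
      · exact measurable_const
      · exact continuous_star.measurable.comp (measurable_pi_apply _)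
      · exact measurable_const
    have hψm : Measurable fun y : ({q // q ∈ ({p} : Finset _)} → ℂ) =>
      y ⟨p, Finset.mem_singleton_self p⟩ := measurable_pi_apply _
    have := hind.comp hψm hφm
    suffices hB : (fun ω a b => eraseEntry (X ω) i j a b)
        = φ ∘ fun ω q => X ω q.1.1.1 q.1.1.2 by
      rw [hB]
      exact this
    refine funext fun ω => funext fun a => funext fun b => ?_
    simp only [Function.comp_apply, hφ, eraseEntry, Matrix.of_apply, Finset.mem_erase,
      Finset.mem_univ, and_true, hp, ne_eq, Subtype.mk.injEq, Prod.mk.injEq]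
    by_cases hab : a ≤ b
    · have h1 : ¬ (a = j ∧ b = i) := by
        rintro ⟨rfl, rfl⟩; exact absurd h (not_lt.mpr hab)
      by_cases h2 : a = i ∧ b = j
      · simp [h2, h.le]
      · simp [h1, h2, hab]
    · have h1 : ¬ (a = i ∧ b = j) := by
        rintro ⟨rfl, rfl⟩; exact hab h.le
      by_cases h2 : b = i ∧ a = j
      · simp [h2, not_le.mpr h]
      · have h3 : ¬ (a = j ∧ b = i) := fun h => h2 ⟨h.2, h.1⟩
        simp [h1, h2, h3, hab, (hX.isHermitian ω).apply a b]
  rcases lt_or_gt_of_ne hij with h | h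
  · exact key i j h
  · have h1 := (key j i h).comp continuous_star.measurable measurable_id
    rw [hX.apply_symm i j]
    have h2 : (fun ω a b => eraseEntry (X ω) i j a b)
        = id ∘ fun ω a b => eraseEntry (X ω) j i a b :=
      funext fun ω => funext fun a => funext fun b => by
        rw [eraseEntry_comm (X ω) j i]; rfl
    rw [h2]
    exact h1

/-- The limiting self-consistent equation `1 + z m + m² = 0`, with an explicit error term. -/
theorem norm_integral_quadratic_le [IsProbabilityMeasure P] (hX : IsWignerMatrix P μ ν X)
    (hN : 0 < N) {z : ℂ} (hz : z.im ≠ 0) :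
    ‖∫ ω, (1 + z * empiricalStieltjes (normalizedWigner (X ω)) z
        + empiricalStieltjes (normalizedWigner (X ω)) z ^ 2) ∂P‖
      ≤ |z.im|⁻¹ * (∫ x, |x| ∂ν) / Real.sqrt N + 2 * |z.im|⁻¹ ^ 2 / N
        + 8 * |z.im|⁻¹ ^ 3 / Real.sqrt N + 4 * |z.im|⁻¹ ^ 2 *
          ∫ x, ‖x‖ ^ 2 * min (|z.im|⁻¹ * (‖x‖ / Real.sqrt N)) 1 ∂μ := by
  set κ := |z.im|⁻¹ with hκ
  have hκ0 : 0 ≤ κ := by positivity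
  have hN' : (0 : ℝ) < N := by exact_mod_cast hN
  have hNc : (N : ℂ) ≠ 0 := by exact_mod_cast hN.ne'
  set s : ℝ := Real.sqrt N with hs
  have hs0 : 0 < s := Real.sqrt_pos.mpr hN'
  have hss : s ^ 2 = N := Real.sq_sqrt hN'.le
  set L : ℝ := ∫ x, ‖x‖ ^ 2 * min (κ * (‖x‖ / s)) 1 ∂μ with hL
  set V : Ω → Matrix (Fin N) (Fin N) ℂ := fun ω => normalizedWigner (X ω) with hV
  set G : Ω → Fin N → Fin N → ℂ := fun ω => matrixResolvent (V ω) z with hGdef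
  have hVh : ∀ ω, (V ω).IsHermitian := fun ω => isHermitian_normalizedWigner (hX.isHermitian ω)
  have hVap : ∀ ω a b, V ω a b = ((1 / s : ℝ) : ℂ) * X ω a b := fun ω a b => rfl
  have hVn : ∀ ω a b, ‖V ω a b‖ = ‖X ω a b‖ / s := fun ω a b => by
    rw [hVap, norm_mul, Complex.norm_real, Real.norm_eq_abs, abs_of_pos (by positivity)]
    ring
  have hVm : ∀ a b, AEMeasurable (fun ω => V ω a b) P := fun a b =>
    (hX.aemeasurable_apply a b).const_mul _
  have hG : ∀ ω a b, ‖G ω a b‖ ≤ κ := fun ω => norm_matrixResolvent_entry_le (hVh ω) hz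
  have hGm : ∀ a b, AEStronglyMeasurable (fun ω => G ω a b) P := fun a b =>
    (aemeasurable_matrixResolvent_apply hVm z a b).aestronglyMeasurable
  have hGG : ∀ a b c d, Integrable (fun ω => G ω a b * G ω c d) P := fun a b c d =>
    Integrable.of_bound ((hGm a b).mul (hGm c d)) (κ * κ) (Eventually.of_forall fun ω => by
      rw [norm_mul]; gcongr <;> exact hG ω _ _)
  have hG2 : ∀ a b, Integrable (fun ω => ‖G ω a b‖ ^ 2) P := fun a b =>
    Integrable.of_bound ((hGm a b).norm.pow 2) (κ ^ 2) (Eventually.of_forall fun ω => by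
      rw [norm_pow, norm_norm]; gcongr; exact hG ω _ _)
  have hVi : ∀ a b, Integrable (fun ω => V ω a b) P := fun a b => by
    by_cases hab : a = b
    · subst hab
      exact (hX.integrable_apply_self a).const_mul _
    · exact ((hX.memLp_apply hab).integrable (by norm_num)).const_mul _
  have hVG : ∀ a b, Integrable (fun ω => V ω a b * G ω b a) P := fun a b =>
    (hVi a b).mul_bdd (c := κ) (hGm b a) (Eventually.of_forall fun ω => hG ω b a)
  -- the quadratic expression as an average over pairs of indices
  have hpt : ∀ ω, 1 + z * empiricalStieltjes (V ω) z + empiricalStieltjes (V ω) z ^ 2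
      = (1 / N : ℂ) ^ 2 *
        ∑ i, ∑ j, ((N : ℂ) * (V ω i j * G ω j i) + G ω i i * G ω j j) := by
    intro ω
    have h1 := sum_mul_matrixResolvent (hVh ω) hz
    rw [Fintype.card_fin] at h1
    have h2 : (∑ i, G ω i i * ∑ j, G ω j j) = (matrixResolvent (V ω) z).trace ^ 2 := by
      rw [← Finset.sum_mul, sq]
      rfl
    have h3 : ∑ i, ∑ j, V ω i j * G ω j i = N + z * (matrixResolvent (V ω) z).trace := h1
    simp only [Finset.sum_add_distrib, ← Finset.mul_sum]
    rw [h2, h3, empiricalStieltjes]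
    field_simp
  have hterm : ∀ i j, Integrable
      (fun ω => (N : ℂ) * (V ω i j * G ω j i) + G ω i i * G ω j j) P := fun i j =>
    ((hVG i j).const_mul _).add (hGG i i j j)
  -- diagonal pairs
  have hdiag : ∀ i, ‖∫ ω, ((N : ℂ) * (V ω i i * G ω i i) + G ω i i * G ω i i) ∂P‖
      ≤ κ * s * (∫ x, |x| ∂ν) + κ ^ 2 := by
    intro i
    have hb : ∀ ω, ‖(N : ℂ) * (V ω i i * G ω i i) + G ω i i * G ω i i‖
        ≤ κ * s * ‖X ω i i‖ + κ ^ 2 := by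
      intro ω
      refine (norm_add_le _ _).trans ?_
      rw [norm_mul, norm_mul, norm_mul, hVn, Complex.norm_natCast]
      calc _ ≤ (N : ℝ) * (‖X ω i i‖ / s * κ) + κ * κ := by
            gcongr <;> exact hG ω _ _
        _ = _ := by rw [← hss]; field_simp
    have hi : Integrable (fun ω => κ * s * ‖X ω i i‖) P :=
      (hX.integrable_apply_self i).norm.const_mul _
    calc _ ≤ ∫ ω, (κ * s * ‖X ω i i‖ + κ ^ 2) ∂P :=
          norm_integral_le_of_norm_le (hi.add (integrable_const _)) (Eventually.of_forall hb)
      _ = _ := by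
          rw [integral_add hi (integrable_const _), integral_const_mul,
            hX.integral_norm_apply_self i]
          simp
  -- off-diagonal pairs
  have hoff : ∀ i j, i ≠ j → ‖∫ ω, ((N : ℂ) * (V ω i j * G ω j i) + G ω i i * G ω j j) ∂P‖
      ≤ ∫ ω, ‖G ω j i‖ ^ 2 ∂P + (8 * κ ^ 3 / s + 4 * κ ^ 2 * L) := by
    intro i j hij
    have hmem := hX.memLp_apply hij
    have hvarX : ∫ ω, ‖X ω i j‖ ^ 2 ∂P = 1 := by
      rw [← hX.variance_offDiag]
      exact hX.integral_comp_norm_apply hij (φ := fun x => x ^ 2) (by fun_prop)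
    have hind : IndepFun (fun ω => V ω i j) (fun ω a b => eraseEntry (V ω) i j a b) P := by
      have := (hX.indepFun_eraseEntry hij).comp
        (φ := fun x : ℂ => ((1 / s : ℝ) : ℂ) * x)
        (ψ := fun (M : Fin N → Fin N → ℂ) a b => ((1 / s : ℝ) : ℂ) * M a b)
        (by fun_prop) (by fun_prop)
      simp only [hV, eraseEntry_normalizedWigner]
      exact this
    have hmean : ∫ ω, V ω i j ∂P = 0 := by
      simp only [hVap]
      rw [integral_const_mul, hX.integral_apply hij, mul_zero]
    have hvar : ∫ ω, ‖V ω i j‖ ^ 2 ∂P = 1 / (N : ℝ) := by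
      simp only [hVn, div_pow, hss]
      rw [integral_div, hvarX]
    have hfirst : ∫ ω, ‖V ω i j‖ ∂P ≤ 1 / s := by
      have h1 : ∫ ω, ‖X ω i j‖ ∂P ≤ 1 := by
        have hint : Integrable (fun ω => ‖X ω i j‖ ^ 2) P := hmem.integrable_norm_pow (by norm_num)
        calc ∫ ω, ‖X ω i j‖ ∂P ≤ ∫ ω, (1 + ‖X ω i j‖ ^ 2) / 2 ∂P := by
              refine integral_mono (hmem.integrable (by norm_num)).norm
                (((integrable_const _).add hint).div_const _) fun ω => ?_
              nlinarith [sq_nonneg (‖X ω i j‖ - 1)]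
          _ = 1 := by
              rw [integral_div, integral_add (integrable_const _) hint, hvarX]
              simp
      simp only [hVn]
      rw [integral_div]
      gcongr
    have hlind : (N : ℝ) * ∫ ω, ‖V ω i j‖ ^ 2 * min (κ * ‖V ω i j‖) 1 ∂P = L := by
      simp only [hVn, div_pow, hss]
      rw [hL, ← hX.integral_comp_norm_apply hij
        (φ := fun x => x ^ 2 * min (κ * (x / s)) 1) (by fun_prop), ← integral_const_mul]
      refine integral_congr_ae (Eventually.of_forall fun ω => ?_)
      simp only
      field_simp
    have hmain := norm_integral_entry_mul_matrixResolvent_le hVh hVm hz hij hind hmean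
      (hmem.const_mul _) hN' hvar
    rw [hlind] at hmain
    refine (hmain.trans ?_)
    rw [add_assoc]
    gcongr
    calc _ ≤ 8 * κ ^ 3 * (1 / s) := by gcongr
      _ = _ := by ring
  have hL0 : 0 ≤ L := integral_nonneg fun x => by positivity
  have hν0 : 0 ≤ ∫ x, |x| ∂ν := integral_nonneg fun x => abs_nonneg x
  have hall : ∀ i j, ‖∫ ω, ((N : ℂ) * (V ω i j * G ω j i) + G ω i i * G ω j j) ∂P‖
      ≤ (if i = j then κ * s * (∫ x, |x| ∂ν) + κ ^ 2 else 0) + (∫ ω, ‖G ω j i‖ ^ 2 ∂P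
        + (8 * κ ^ 3 / s + 4 * κ ^ 2 * L)) := by
    intro i j
    have h0 : 0 ≤ ∫ ω, ‖G ω j i‖ ^ 2 ∂P := integral_nonneg fun ω => by positivity
    by_cases hij : i = j
    · subst hij
      rw [if_pos rfl]
      have := hdiag i
      have : 0 ≤ 8 * κ ^ 3 / s + 4 * κ ^ 2 * L := by positivity
      linarith
    · rw [if_neg hij, zero_add]
      exact hoff i j hij
  have hcol : ∀ i, ∑ j, ∫ ω, ‖G ω j i‖ ^ 2 ∂P ≤ κ ^ 2 := by
    intro i
    rw [← integral_finsetSum _ fun j _ => hG2 j i]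
    calc _ ≤ ∫ _ω, κ ^ 2 ∂P := by
          refine integral_mono (integrable_finsetSum _ fun j _ => hG2 j i) (integrable_const _)
            fun ω => ?_
          refine (sum_norm_sq_column_le (matrixResolvent (V ω) z) i).trans ?_
          gcongr
          exact norm_matrixResolvent_le (hVh ω) hz
      _ = κ ^ 2 := by simp
  change ‖∫ ω, (1 + z * empiricalStieltjes (V ω) z + empiricalStieltjes (V ω) z ^ 2) ∂P‖ ≤ _
  simp_rw [hpt]
  rw [integral_const_mul,
    integral_finsetSum _ fun i _ => integrable_finsetSum _ fun j _ => hterm i j]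
  simp_rw [integral_finsetSum _ fun j _ => hterm _ j]
  rw [norm_mul, norm_pow, norm_div, norm_one, Complex.norm_natCast]
  calc _ ≤ (1 / (N : ℝ)) ^ 2 * ∑ i : Fin N, ∑ j : Fin N,
        ((if i = j then κ * s * (∫ x, |x| ∂ν) + κ ^ 2 else 0) + (∫ ω, ‖G ω j i‖ ^ 2 ∂P
        + (8 * κ ^ 3 / s + 4 * κ ^ 2 * L))) := by
        gcongr
        exact norm_sum_le_of_le _ fun i _ => norm_sum_le_of_le _ fun j _ => hall i j
    _ ≤ (1 / (N : ℝ)) ^ 2 * ∑ i : Fin N, ((κ * s * (∫ x, |x| ∂ν) + κ ^ 2) + (κ ^ 2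
        + N * (8 * κ ^ 3 / s + 4 * κ ^ 2 * L))) := by
        gcongr with i
        rw [Finset.sum_add_distrib, Finset.sum_add_distrib, Finset.sum_ite_eq,
          if_pos (Finset.mem_univ i), Finset.sum_const, Finset.card_univ, Fintype.card_fin,
          nsmul_eq_mul]
        gcongr
        exact hcol i
    _ = _ := by
        rw [Finset.sum_const, Finset.card_univ, Fintype.card_fin, nsmul_eq_mul, ← hss]
        field_simp
        ring

end IsWignerMatrix

/-! ### Concentration and almost sure convergence of the Stieltjes transform -/

/-- Disjoint blocks of an independent family are independent. -/
theorem iIndepFun_blocks {Ω : Type*} [MeasurableSpace Ω] {P : Measure Ω} {ι : Type*} [Countable ι]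
    {κ : ι → Type*} [∀ i, Countable (κ i)] {E : Type*} [MeasurableSpace E]
    {X : (p : (i : ι) × κ i) → Ω → E} (hX : iIndepFun X P) (hm : ∀ p, AEMeasurable (X p) P) :
    iIndepFun (fun (i : ι) (ω : Ω) (j : κ i) => X ⟨i, j⟩ ω) P := by
  have hP := hX.isProbabilityMeasure
  have hprob : ∀ p, IsProbabilityMeasure (P.map (X p)) := fun p =>
    Measure.isProbabilityMeasure_map (hm p)
  have hblock : ∀ i, AEMeasurable (fun (ω : Ω) (j : κ i) => X ⟨i, j⟩ ω) P := fun i =>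
    aemeasurable_pi_lambda _ fun j => hm _
  have hlaw : ∀ i, P.map (fun (ω : Ω) (j : κ i) => X ⟨i, j⟩ ω)
      = Measure.infinitePi fun j => P.map (X ⟨i, j⟩) := fun i =>
    (hX.precomp (g := fun j : κ i => (⟨i, j⟩ : (i : ι) × κ i))
      sigma_mk_injective).map_fun_eq_infinitePi_map₀' fun j => hm _
  rw [iIndepFun_iff_map_fun_eq_infinitePi_map₀' hblock]
  simp only [hlaw]
  rw [← Measure.infinitePi_map_piCurry (fun i j => P.map (X ⟨i, j⟩)),
    ← hX.map_fun_eq_infinitePi_map₀' hm, AEMeasurable.map_map_of_aemeasurable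
      (MeasurableEquiv.measurable _).aemeasurable (aemeasurable_pi_lambda _ hm)]
  rfl

/-- The Hermitian matrix whose upper triangular part is read off from a family of columns; the
real part is taken on the diagonal. -/
noncomputable def hermitianOfColumns {N : ℕ} (y : Fin N → Fin N → ℂ) : Matrix (Fin N) (Fin N) ℂ :=
  Matrix.of fun a b => if a < b then y b a else if a = b then ((y a a).re : ℂ) else star (y a b)

theorem isHermitian_hermitianOfColumns {N : ℕ} (y : Fin N → Fin N → ℂ) :
    (hermitianOfColumns y).IsHermitian := by
  ext a b
  simp only [Matrix.conjTranspose_apply, hermitianOfColumns, Matrix.of_apply]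
  rcases lt_trichotomy a b with h | rfl | h
  · rw [if_neg h.not_gt, if_neg h.ne', if_pos h, star_star]
  · simp
  · rw [if_pos h, if_neg h.not_gt, if_neg h.ne']

theorem measurable_hermitianOfColumns_apply {N : ℕ} (a b : Fin N) :
    Measurable fun y : Fin N → Fin N → ℂ => hermitianOfColumns y a b := by
  simp only [hermitianOfColumns, Matrix.of_apply]
  split_ifs
  · fun_prop
  · fun_prop
  · exact continuous_star.measurable.comp (by fun_prop)

theorem hermitianOfColumns_update {N : ℕ} (y : Fin N → Fin N → ℂ) (k : Fin N) (c : Fin N → ℂ)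
    {a b : Fin N} (ha : a ≠ k) (hb : b ≠ k) :
    hermitianOfColumns (Function.update y k c) a b = hermitianOfColumns y a b := by
  simp only [hermitianOfColumns, Matrix.of_apply, Function.update_of_ne ha,
    Function.update_of_ne hb]

/-- Changing one column of the upper triangular part of an `N × N` matrix moves the normalized
trace of the resolvent by at most `4 / (N |Im z|)`. -/
theorem norm_empiricalStieltjes_update_sub_le {N : ℕ} (y : Fin N → Fin N → ℂ) (k : Fin N)
    (c : Fin N → ℂ) {z : ℂ} (hz : z.im ≠ 0) :
    ‖empiricalStieltjes (normalizedWigner (hermitianOfColumns (Function.update y k c))) z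
      - empiricalStieltjes (normalizedWigner (hermitianOfColumns y)) z‖ ≤ 4 * |z.im|⁻¹ / N := by
  rw [empiricalStieltjes, empiricalStieltjes, ← mul_sub, norm_mul, norm_div, norm_one,
    Complex.norm_natCast]
  have := norm_trace_matrixResolvent_sub_le (k := k)
    (isHermitian_normalizedWigner (isHermitian_hermitianOfColumns (Function.update y k c)))
    (isHermitian_normalizedWigner (isHermitian_hermitianOfColumns y)) hz fun i j hi hj => by
      rw [normalizedWigner_apply, normalizedWigner_apply, hermitianOfColumns_update y k c hi hj]
  calc _ ≤ 1 / (N : ℝ) * (4 * |z.im|⁻¹) := by gcongr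
    _ = _ := by ring

theorem aemeasurable_empiricalStieltjes {Ω : Type*} [MeasurableSpace Ω] {P : Measure Ω} {N : ℕ}
    {A : Ω → Matrix (Fin N) (Fin N) ℂ} (hA : ∀ a b, AEMeasurable (fun ω => A ω a b) P) (z : ℂ) :
    AEMeasurable (fun ω => empiricalStieltjes (A ω) z) P := by
  simp only [empiricalStieltjes, Matrix.trace, Matrix.diag_apply]
  exact (Finset.aemeasurable_fun_sum _
    fun i _ => aemeasurable_matrixResolvent_apply hA z i i).const_mul _

theorem measurable_empiricalStieltjes_hermitianOfColumns {N : ℕ} (z : ℂ) :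
    Measurable fun y : Fin N → Fin N → ℂ =>
      empiricalStieltjes (normalizedWigner (hermitianOfColumns y)) z := by
  simp only [empiricalStieltjes, Matrix.trace, Matrix.diag_apply]
  refine (Finset.measurable_fun_sum _ fun i _ => ?_).const_mul _
  refine (measurable_matrixResolvent_apply z i i).comp
    (f := fun y : Fin N → Fin N → ℂ => fun a b => normalizedWigner (hermitianOfColumns y) a b) ?_
  exact measurable_pi_lambda _ fun a => measurable_pi_lambda _ fun b =>
    (measurable_hermitianOfColumns_apply a b).const_mul _

/-- A form of the Borel–Cantelli lemma that needs no assumption on the joint law of the sequence. -/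
theorem ae_tendsto_zero_of_summable_measureReal {Ω : Type*} [MeasurableSpace Ω] {P : Measure Ω}
    [IsFiniteMeasure P] {D : ℕ → Ω → ℝ}
    (h : ∀ ε > 0, Summable fun n => P.real {ω | ε ≤ |D n ω|}) :
    ∀ᵐ ω ∂P, Tendsto (fun n => D n ω) atTop (𝓝 0) := by
  have h1 : ∀ k : ℕ, ∀ᵐ ω ∂P, ∀ᶠ n in atTop, |D n ω| < 1 / ((k : ℝ) + 1) := by
    intro k
    have hs := h (1 / ((k : ℝ) + 1)) (by positivity)
    have := ae_eventually_notMem (μ := P) (s := fun n => {ω | 1 / ((k : ℝ) + 1) ≤ |D n ω|}) (by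
      have h2 : ∀ n, P {ω | 1 / ((k : ℝ) + 1) ≤ |D n ω|}
          = ENNReal.ofReal (P.real {ω | 1 / ((k : ℝ) + 1) ≤ |D n ω|}) := fun n =>
        (ofReal_measureReal).symm
      simp only [h2]
      exact hs.tsum_ofReal_ne_top)
    filter_upwards [this] with ω hω
    filter_upwards [hω] with n hn
    exact not_le.mp hn
  filter_upwards [ae_all_iff.mpr h1] with ω hω
  rw [Metric.tendsto_nhds]
  intro ε hε
  obtain ⟨k, hk⟩ := exists_nat_one_div_lt hε
  filter_upwards [hω k] with n hn
  rw [Real.dist_eq, sub_zero]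
  exact hn.trans hk

namespace IsWignerMatrix

variable {Ω : Type*} [MeasurableSpace Ω] {P : Measure Ω} {μ : Measure ℂ} {ν : Measure ℝ} {N : ℕ}
  {X : Ω → Matrix (Fin N) (Fin N) ℂ}

theorem aemeasurable_normalizedWigner_apply (hX : IsWignerMatrix P μ ν X) (a b : Fin N) :
    AEMeasurable (fun ω => normalizedWigner (X ω) a b) P :=
  (hX.aemeasurable_apply a b).const_mul _

/-- The columns of the upper triangular part are independent. -/
theorem iIndepFun_columns (hX : IsWignerMatrix P μ ν X) :
    iIndepFun (fun (k : Fin N) ω i => if i ≤ k then X ω i k else 0) P := by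
  have h1 := hX.indep.precomp
    (g := fun p : (k : Fin N) × {i : Fin N // i ≤ k} => ⟨(p.2.1, p.1), p.2.2⟩) (by
      rintro ⟨k, i, hi⟩ ⟨k', i', hi'⟩ h
      simp only [Subtype.mk.injEq, Prod.mk.injEq] at h
      obtain ⟨rfl, rfl⟩ := h
      rfl)
  have h2 := iIndepFun_blocks h1 (fun p => hX.aemeasurable_apply _ _)
  have h3 := h2.comp (fun k (y : {i : Fin N // i ≤ k} → ℂ) (i : Fin N) =>
    if hi : i ≤ k then y ⟨i, hi⟩ else 0) (fun k => by
      refine measurable_pi_lambda _ fun i => ?_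
      split_ifs <;> fun_prop)
  convert h3 using 1
  refine funext fun k => funext fun ω => funext fun i => ?_
  simp only [Function.comp_apply]
  split_ifs <;> rfl

theorem hermitianOfColumns_eq (hX : IsWignerMatrix P μ ν X) (ω : Ω) :
    hermitianOfColumns (fun k i => if i ≤ k then X ω i k else 0) = X ω := by
  ext a b
  simp only [hermitianOfColumns, Matrix.of_apply]
  rcases lt_trichotomy a b with h | rfl | h
  · rw [if_pos h, if_pos h.le]
  · rw [if_neg (lt_irrefl a), if_pos rfl, if_pos le_rfl]
    exact (hX.isHermitian ω).coe_re_apply_self a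
  · rw [if_neg h.not_gt, if_neg h.ne', if_pos h.le]
    exact (hX.isHermitian ω).apply a b

/-- Concentration of the normalized trace of the resolvent. The function `f` is meant to be the
real or the imaginary part. -/
theorem measureReal_abs_sub_ge_le [IsProbabilityMeasure P] (hX : IsWignerMatrix P μ ν X) {z : ℂ}
    (hz : z.im ≠ 0) {f : ℂ → ℝ} (hf : Measurable f) (hfb : ∀ w, |f w| ≤ ‖w‖)
    (hfl : ∀ w w', |f w - f w'| ≤ ‖w - w'‖) {ε : ℝ} (hε : 0 ≤ ε) :
    P.real {ω | ε ≤ |f (empiricalStieltjes (normalizedWigner (X ω)) z)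
        - ∫ ω, f (empiricalStieltjes (normalizedWigner (X ω)) z) ∂P|}
      ≤ 2 * Real.exp (-(ε ^ 2 / (32 * |z.im|⁻¹ ^ 2)) * N) := by
  rcases Nat.eq_zero_or_pos N with rfl | hN
  · simpa using measureReal_le_one.trans one_le_two
  have hN' : (0 : ℝ) < N := by exact_mod_cast hN
  have hκ : 0 < |z.im|⁻¹ := inv_pos.mpr (abs_pos.mpr hz)
  set Y : Ω → Fin N → Fin N → ℂ := fun ω k i => if i ≤ k then X ω i k else 0 with hY
  have hYm : ∀ k, AEMeasurable (fun ω => Y ω k) P := fun k =>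
    aemeasurable_pi_lambda _ fun i => by
      simp only [hY]
      split_ifs
      · exact hX.aemeasurable_apply i k
      · exact aemeasurable_const
  have hYm' : AEMeasurable Y P := aemeasurable_pi_lambda _ hYm
  have hprob : ∀ k, IsProbabilityMeasure (P.map fun ω => Y ω k) := fun k =>
    Measure.isProbabilityMeasure_map (hYm k)
  have hlaw : P.map Y = Measure.pi fun k => P.map fun ω => Y ω k :=
    hX.iIndepFun_columns.map_fun_eq_pi_map hYm
  set F : (Fin N → Fin N → ℂ) → ℝ := fun y =>
    f (empiricalStieltjes (normalizedWigner (hermitianOfColumns y)) z) with hF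
  have hFm : Measurable F := hf.comp (measurable_empiricalStieltjes_hermitianOfColumns z)
  have hFY : ∀ ω, F (Y ω) = f (empiricalStieltjes (normalizedWigner (X ω)) z) := fun ω => by
    simp only [hF, hY, hX.hermitianOfColumns_eq ω]
  set c : ℝ≥0 := ⟨4 * |z.im|⁻¹ / N, by positivity⟩ with hc
  have h := measureReal_abs_sub_integral_ge_le c (fun k => P.map fun ω => Y ω k) hFm
    (C := |z.im|⁻¹)
    (fun y => (hfb _).trans (norm_empiricalStieltjes_le
      (isHermitian_normalizedWigner (isHermitian_hermitianOfColumns y)) hz))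
    (fun y k x => (hfl _ _).trans (norm_empiricalStieltjes_update_sub_le y k x hz)) hε
  rw [← hlaw, integral_map hYm' hFm.aestronglyMeasurable,
    map_measureReal_apply_of_aemeasurable hYm'
      (measurableSet_le measurable_const (by fun_prop))] at h
  simp only [hFY, Set.preimage_ofPred_eq] at h
  refine h.trans (le_of_eq ?_)
  congr 2
  have hcv : (c : ℝ) = 4 * |z.im|⁻¹ / N := rfl
  rw [hcv]
  field_simp
  ring

end IsWignerMatrix

/-- The normalized trace of the resolvent is almost surely asymptotic to its expectation. -/
theorem ae_tendsto_empiricalStieltjes_sub_integral {Ω : Type*} [MeasurableSpace Ω]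
    {P : Measure Ω} [IsProbabilityMeasure P] {μ : Measure ℂ} {ν : Measure ℝ}
    {X : (N : ℕ) → Ω → Matrix (Fin N) (Fin N) ℂ} (hX : ∀ N, IsWignerMatrix P μ ν (X N)) {z : ℂ}
    (hz : z.im ≠ 0) :
    ∀ᵐ ω ∂P, Tendsto (fun N => empiricalStieltjes (normalizedWigner (X N ω)) z
      - ∫ ω, empiricalStieltjes (normalizedWigner (X N ω)) z ∂P) atTop (𝓝 0) := by
  have key : ∀ f : ℂ → ℝ, Measurable f → (∀ w, |f w| ≤ ‖w‖) →
      (∀ w w', |f w - f w'| ≤ ‖w - w'‖) →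
      ∀ᵐ ω ∂P, Tendsto (fun N => f (empiricalStieltjes (normalizedWigner (X N ω)) z)
        - ∫ ω, f (empiricalStieltjes (normalizedWigner (X N ω)) z) ∂P) atTop (𝓝 0) := by
    intro f hf hfb hfl
    refine ae_tendsto_zero_of_summable_measureReal fun ε hε => ?_
    refine Summable.of_nonneg_of_le (fun _ => measureReal_nonneg)
      (fun N => (hX N).measureReal_abs_sub_ge_le hz hf hfb hfl hε.le) ?_
    have hκ : 0 < |z.im|⁻¹ := inv_pos.mpr (abs_pos.mpr hz)
    have := Real.summable_exp_nat_mul_iff.mpr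
      (show -(ε ^ 2 / (32 * |z.im|⁻¹ ^ 2)) < 0 from neg_lt_zero.mpr (by positivity))
    refine (this.mul_left 2).congr fun N => ?_
    rw [mul_comm (N : ℝ)]
  have hint : ∀ N, Integrable (fun ω => empiricalStieltjes (normalizedWigner (X N ω)) z) P :=
    fun N => Integrable.of_bound
      (aemeasurable_empiricalStieltjes (hX N).aemeasurable_normalizedWigner_apply
        z).aestronglyMeasurable |z.im|⁻¹ (Eventually.of_forall fun ω =>
          norm_empiricalStieltjes_le (isHermitian_normalizedWigner ((hX N).isHermitian ω)) hz)
  filter_upwards [key Complex.re Complex.measurable_re Complex.abs_re_le_norm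
      (fun w w' => by rw [← Complex.sub_re]; exact Complex.abs_re_le_norm _),
    key Complex.im Complex.measurable_im Complex.abs_im_le_norm
      (fun w w' => by rw [← Complex.sub_im]; exact Complex.abs_im_le_norm _)] with ω hre him
  have hre' : ∀ N, ∫ ω, (empiricalStieltjes (normalizedWigner (X N ω)) z).re ∂P
      = (∫ ω, empiricalStieltjes (normalizedWigner (X N ω)) z ∂P).re := fun N => by
    simpa using integral_re (hint N)
  have him' : ∀ N, ∫ ω, (empiricalStieltjes (normalizedWigner (X N ω)) z).im ∂P
      = (∫ ω, empiricalStieltjes (normalizedWigner (X N ω)) z ∂P).im := fun N => by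
    simpa using integral_im (hint N)
  simp only [hre', him', ← Complex.sub_re, ← Complex.sub_im] at hre him
  have h := (Complex.continuous_ofReal.tendsto 0).comp hre |>.add
    (((Complex.continuous_ofReal.tendsto 0).comp him).mul_const Complex.I)
  simp only [Function.comp_def, Complex.re_add_im, Complex.ofReal_zero, zero_mul, add_zero] at h
  exact h

/-- The Lindeberg-type remainder vanishes in the limit, with no assumption beyond finite second
moments. -/
theorem tendsto_integral_sq_mul_min {μ : Measure ℂ} (h2 : MemLp (fun z : ℂ => z) 2 μ) {κ : ℝ}
    (hκ : 0 ≤ κ) :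
    Tendsto (fun N : ℕ => ∫ x, ‖x‖ ^ 2 * min (κ * (‖x‖ / Real.sqrt N)) 1 ∂μ) atTop (𝓝 0) := by
  have h : Tendsto (fun N : ℕ => ∫ x, ‖x‖ ^ 2 * min (κ * (‖x‖ / Real.sqrt N)) 1 ∂μ) atTop
      (𝓝 (∫ _x : ℂ, (0 : ℝ) ∂μ)) := by
    refine tendsto_integral_of_dominated_convergence (fun x => ‖x‖ ^ 2)
      (fun N => Measurable.aestronglyMeasurable (by fun_prop))
      (h2.integrable_norm_pow (by norm_num)) (fun N => Eventually.of_forall fun x => ?_)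
      (Eventually.of_forall fun x => ?_)
    · rw [Real.norm_eq_abs, abs_of_nonneg (by positivity)]
      exact mul_le_of_le_one_right (by positivity) (min_le_right _ _)
    · have hs : Tendsto (fun N : ℕ => Real.sqrt (N : ℝ)) atTop atTop :=
        Real.tendsto_sqrt_atTop.comp tendsto_natCast_atTop_atTop
      have h1 : Tendsto (fun N : ℕ => κ * (‖x‖ / Real.sqrt N)) atTop (𝓝 (κ * 0)) :=
        (tendsto_const_nhds.div_atTop hs).const_mul κ
      have h3 := (h1.min (tendsto_const_nhds (x := (1 : ℝ)))).const_mul (‖x‖ ^ 2)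
      simpa using h3
  simpa using h

/-- Stability of the self-consistent equation: the root outside the unit disc lies in the other
half-plane, so approximate solutions in the right half-plane are close to the root in the disc. -/
theorem tendsto_of_tendsto_quadratic {z m : ℂ} (hz : z.im ≠ 0) (hm : m ^ 2 + z * m + 1 = 0)
    (hm1 : ‖m‖ < 1) {u : ℕ → ℂ} (hu : ∀ n, 0 ≤ (u n).im * z.im)
    (h : Tendsto (fun n => 1 + z * u n + u n ^ 2) atTop (𝓝 0)) :
    Tendsto u atTop (𝓝 m) := by
  have hm0 : m ≠ 0 := by rintro rfl; simp at hm
  have hzm : z = -(m + m⁻¹) := by field_simp; linear_combination hm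
  have hns : 0 < Complex.normSq m := Complex.normSq_pos.mpr hm0
  have hns1 : Complex.normSq m < 1 := by
    rw [Complex.normSq_eq_norm_sq]
    nlinarith [norm_nonneg m]
  have hinvim : (m⁻¹).im = -m.im / Complex.normSq m := Complex.inv_im m
  have hzim : z.im = m.im * ((1 - Complex.normSq m) / Complex.normSq m) := by
    rw [hzm, Complex.neg_im, Complex.add_im, hinvim]
    field_simp
    ring
  have hmim : m.im ≠ 0 := by
    intro h0
    rw [h0, zero_mul] at hzim
    exact hz hzim
  have hsign : (m⁻¹).im * z.im < 0 := by
    rw [hinvim, hzim]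
    have : -m.im / Complex.normSq m * (m.im * ((1 - Complex.normSq m) / Complex.normSq m))
        = -(m.im ^ 2 * (1 - Complex.normSq m) / Complex.normSq m ^ 2) := by
      field_simp
    rw [this, neg_lt_zero]
    have : 0 < 1 - Complex.normSq m := by linarith
    positivity
  have hδ : 0 < |(m⁻¹).im| := by
    rw [abs_pos]
    intro h0
    rw [h0, zero_mul] at hsign
    exact lt_irrefl _ hsign
  have hlow : ∀ n, |(m⁻¹).im| ≤ ‖u n - m⁻¹‖ := by
    intro n
    refine le_trans ?_ (Complex.abs_im_le_norm _)
    rw [Complex.sub_im]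
    rcases lt_or_gt_of_ne hz with h1 | h1
    · have h2 : (u n).im ≤ 0 := by nlinarith [hu n]
      have h3 : 0 < (m⁻¹).im := by nlinarith
      rw [abs_of_pos h3, abs_of_nonpos (by linarith)]
      linarith
    · have h2 : 0 ≤ (u n).im := by nlinarith [hu n]
      have h3 : (m⁻¹).im < 0 := by nlinarith
      rw [abs_of_neg h3, abs_of_nonneg (by linarith)]
      linarith
  have hfac : ∀ n, 1 + z * u n + u n ^ 2 = (u n - m) * (u n - m⁻¹) := by
    intro n
    rw [hzm]
    field_simp
    ring
  rw [tendsto_iff_norm_sub_tendsto_zero]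
  have hnorm := h.norm.div_const |(m⁻¹).im|
  rw [norm_zero, zero_div] at hnorm
  refine squeeze_zero (fun _ => norm_nonneg _) (fun n => ?_) hnorm
  rw [le_div_iff₀ hδ, hfac, norm_mul]
  gcongr
  exact hlow n

/-- The normalized trace of the resolvent at `z` converges almost surely to the root of
`m ^ 2 + z m + 1 = 0` in the unit disc. -/
theorem ae_tendsto_empiricalStieltjes {Ω : Type*} [MeasurableSpace Ω]
    {P : Measure Ω} [IsProbabilityMeasure P] {μ : Measure ℂ} {ν : Measure ℝ}
    {X : (N : ℕ) → Ω → Matrix (Fin N) (Fin N) ℂ} (hX : ∀ N, IsWignerMatrix P μ ν (X N)) {z m : ℂ}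
    (hz : z.im ≠ 0) (hm : m ^ 2 + z * m + 1 = 0) (hm1 : ‖m‖ < 1) :
    ∀ᵐ ω ∂P, Tendsto (fun N => empiricalStieltjes (normalizedWigner (X N ω)) z) atTop (𝓝 m) := by
  set κ := |z.im|⁻¹ with hκ
  have hκ0 : 0 ≤ κ := by positivity
  set S : ℕ → Ω → ℂ := fun N ω => empiricalStieltjes (normalizedWigner (X N ω)) z with hS
  set e : ℕ → ℂ := fun N => ∫ ω, S N ω ∂P with he
  have hherm : ∀ N ω, (normalizedWigner (X N ω)).IsHermitian := fun N ω =>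
    isHermitian_normalizedWigner ((hX N).isHermitian ω)
  have hSb : ∀ N ω, ‖S N ω‖ ≤ κ := fun N ω => norm_empiricalStieltjes_le (hherm N ω) hz
  have hSm : ∀ N, AEStronglyMeasurable (S N) P := fun N =>
    (aemeasurable_empiricalStieltjes (hX N).aemeasurable_normalizedWigner_apply
      z).aestronglyMeasurable
  have hSi : ∀ N, Integrable (S N) P := fun N =>
    Integrable.of_bound (hSm N) κ (Eventually.of_forall (hSb N))
  have hS2i : ∀ N, Integrable (fun ω => S N ω ^ 2) P := fun N =>
    Integrable.of_bound ((hSm N).pow 2) (κ ^ 2) (Eventually.of_forall fun ω => by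
      rw [norm_pow]; gcongr; exact hSb N ω)
  have heb : ∀ N, ‖e N‖ ≤ κ := fun N => by
    have := norm_integral_le_of_norm_le_const (μ := P) (Eventually.of_forall (hSb N))
    simpa using this
  have hconc : ∀ᵐ ω ∂P, Tendsto (fun N => S N ω - e N) atTop (𝓝 0) :=
    ae_tendsto_empiricalStieltjes_sub_integral hX hz
  -- the variance vanishes in the limit
  have hvar : Tendsto (fun N => ∫ ω, (S N ω - e N) ^ 2 ∂P) atTop (𝓝 0) := by
    have h := tendsto_integral_of_dominated_convergence (μ := P)
      (F := fun N ω => (S N ω - e N) ^ 2) (f := fun _ => (0 : ℂ)) (fun _ => (2 * κ) ^ 2)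
      (fun N => ((hSm N).sub aestronglyMeasurable_const).pow 2) (integrable_const _)
      (fun N => Eventually.of_forall fun ω => by
        rw [norm_pow]
        gcongr
        exact (norm_sub_le _ _).trans (by linarith [hSb N ω, heb N]))
      (by
        filter_upwards [hconc] with ω hω
        simpa using hω.pow 2)
    simpa using h
  have hvar_eq : ∀ N, ∫ ω, (S N ω - e N) ^ 2 ∂P = ∫ ω, S N ω ^ 2 ∂P - e N ^ 2 := by
    intro N
    have h1 : ∀ ω, (S N ω - e N) ^ 2 = S N ω ^ 2 - 2 * e N * S N ω + e N ^ 2 := fun ω => by ring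
    have i1 : Integrable (fun ω => 2 * e N * S N ω) P := (hSi N).const_mul _
    have i2 : Integrable (fun ω => S N ω ^ 2 - 2 * e N * S N ω) P := (hS2i N).sub i1
    simp_rw [h1]
    rw [integral_add i2 (integrable_const _), integral_sub (hS2i N) i1, integral_const_mul,
      integral_const, probReal_univ, one_smul]
    ring
  have hquad : Tendsto (fun N => ∫ ω, (1 + z * S N ω + S N ω ^ 2) ∂P) atTop (𝓝 0) := by
    have hs : Tendsto (fun N : ℕ => Real.sqrt (N : ℝ)) atTop atTop :=
      Real.tendsto_sqrt_atTop.comp tendsto_natCast_atTop_atTop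
    have l1 := (tendsto_const_nhds (x := κ * ∫ x, |x| ∂ν)).div_atTop hs
    have l2 := (tendsto_const_nhds (x := 2 * κ ^ 2)).div_atTop
      (tendsto_natCast_atTop_atTop (R := ℝ))
    have l3 := (tendsto_const_nhds (x := 8 * κ ^ 3)).div_atTop hs
    have l4 := (tendsto_integral_sq_mul_min (hX 0).memLp_offDiag hκ0).const_mul (4 * κ ^ 2)
    have l := ((l1.add l2).add l3).add l4
    simp only [add_zero, mul_zero] at l
    refine squeeze_zero_norm' ?_ l
    filter_upwards [eventually_gt_atTop 0] with N hN
    exact (hX N).norm_integral_quadratic_le hN hz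
  have hquad_eq : ∀ N, 1 + z * e N + e N ^ 2
      = ∫ ω, (1 + z * S N ω + S N ω ^ 2) ∂P - ∫ ω, (S N ω - e N) ^ 2 ∂P := by
    intro N
    have i1 : Integrable (fun ω => z * S N ω) P := (hSi N).const_mul _
    have i2 : Integrable (fun ω => 1 + z * S N ω) P := (integrable_const _).add i1
    rw [hvar_eq, integral_add i2 (hS2i N), integral_add (integrable_const _) i1,
      integral_const_mul, integral_const, probReal_univ, one_smul]
    ring
  have hsign : ∀ N, 0 ≤ (e N).im * z.im := by
    intro N
    have h1 : (e N).im = ∫ ω, (S N ω).im ∂P := by simpa using (integral_im (hSi N)).symm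
    rw [h1, ← integral_mul_const]
    exact integral_nonneg fun ω => im_empiricalStieltjes_mul_im_nonneg (hherm N ω) hz
  have hlim : Tendsto e atTop (𝓝 m) := by
    refine tendsto_of_tendsto_quadratic hz hm hm1 hsign ?_
    simp only [hquad_eq]
    simpa using hquad.sub hvar
  filter_upwards [hconc] with ω hω
  simpa using hω.add hlim

/-! ### The empirical spectral distribution -/

/-- The empirical spectral measure `(1 / N) ∑ δ_{λ_i}` of a Hermitian matrix of size `N`; by
convention, the Dirac mass at zero when `N = 0`. -/
noncomputable def empiricalMeasure {N : ℕ} {A : Matrix (Fin N) (Fin N) ℂ} (hA : A.IsHermitian) :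
    Measure ℝ :=
  if N = 0 then Measure.dirac 0
  else (N : ENNReal)⁻¹ • ∑ i : Fin N, Measure.dirac (hA.eigenvalues i)

instance isProbabilityMeasure_empiricalMeasure {N : ℕ} {A : Matrix (Fin N) (Fin N) ℂ}
    (hA : A.IsHermitian) : IsProbabilityMeasure (empiricalMeasure hA) := by
  unfold empiricalMeasure
  split_ifs with hN
  · infer_instance
  · constructor
    simp [ENNReal.inv_mul_cancel (Nat.cast_ne_zero.mpr hN) (ENNReal.natCast_ne_top N)]

theorem integral_empiricalMeasure {N : ℕ} (hN : N ≠ 0) {A : Matrix (Fin N) (Fin N) ℂ}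
    (hA : A.IsHermitian) (g : ℝ → ℂ) :
    ∫ x, g x ∂(empiricalMeasure hA) = 1 / (N : ℂ) * ∑ i, g (hA.eigenvalues i) := by
  rw [empiricalMeasure, if_neg hN, integral_smul_measure,
    integral_finsetSum_measure fun i _ => integrable_dirac (by simp)]
  simp

theorem measureReal_Iic_empiricalMeasure {N : ℕ} (hN : N ≠ 0) {A : Matrix (Fin N) (Fin N) ℂ}
    (hA : A.IsHermitian) (x : ℝ) :
    (empiricalMeasure hA).real (Set.Iic x) = esd hA x := by
  rw [empiricalMeasure, if_neg hN, esd, measureReal_ennreal_smul_apply, measureReal_def,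
    Measure.finsetSum_apply, ENNReal.toReal_sum fun i _ => measure_ne_top _ _]
  simp [Set.indicator_apply, apply_ite ENNReal.toReal]

/-- The resolvent of `α + β V` is a rescaled resolvent of `V`. -/
theorem matrixResolvent_shiftScale (α : ℝ) {β : ℝ} (hβ : 0 < β) {N : ℕ}
    {V : Matrix (Fin N) (Fin N) ℂ} (hV : V.IsHermitian) {w : ℂ} (hw : w.im ≠ 0) :
    matrixResolvent (shiftScale α β V) w = (β : ℂ)⁻¹ • matrixResolvent V ((w - α) / β) := by
  have hβ' : (β : ℂ) ≠ 0 := by exact_mod_cast hβ.ne'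
  have him : ((w - α) / β).im ≠ 0 := by
    rw [Complex.div_ofReal_im]
    simpa using ⟨hw, hβ.ne'⟩
  refine Matrix.inv_eq_right_inv ?_
  have h1 : shiftScale α β V - w • (1 : Matrix (Fin N) (Fin N) ℂ)
      = (β : ℂ) • (V - ((w - α) / β) • (1 : Matrix (Fin N) (Fin N) ℂ)) := by
    rw [shiftScale, smul_sub, smul_smul, mul_div_cancel₀ _ hβ', sub_smul]
    abel
  rw [h1, smul_mul_smul_comm, mul_inv_cancel₀ hβ', one_smul,
    sub_smul_one_mul_matrixResolvent hV him]

theorem integral_inv_sub_empiricalMeasure_shiftScale (α : ℝ) {β : ℝ} (hβ : 0 < β) {N : ℕ}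
    (hN : N ≠ 0) {X : Matrix (Fin N) (Fin N) ℂ} (hX : X.IsHermitian) {w : ℂ} (hw : w.im ≠ 0) :
    ∫ x : ℝ, ((x : ℂ) - w)⁻¹
        ∂(empiricalMeasure (isHermitian_shiftScale_normalizedWigner α β hX))
      = empiricalStieltjes (normalizedWigner X) ((w - α) / β) / β := by
  rw [integral_empiricalMeasure hN _ (fun x : ℝ => ((x : ℂ) - w)⁻¹), ← trace_matrixResolvent _ hw,
    matrixResolvent_shiftScale α hβ (isHermitian_normalizedWigner hX) hw, Matrix.trace_smul,
    empiricalStieltjes, smul_eq_mul]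
  ring

theorem propositionT {Ω : Type*} [MeasurableSpace Ω] (P : Measure Ω) [IsProbabilityMeasure P]
    (μ : Measure ℂ) (ν : Measure ℝ)
    (X : (N : ℕ) → Ω → Matrix (Fin N) (Fin N) ℂ)
    (hX : ∀ N : ℕ, IsWignerMatrix P μ ν (X N))
    (α β : ℝ) (hα : 0 ≤ α) (hβ : 0 < β) :
    IsProbabilityMeasure (semicircleLaw α β) ∧
    ∀ᵐ ω ∂P, ∀ x : ℝ,
      Tendsto
        (fun N : ℕ =>
          esd (isHermitian_shiftScale_normalizedWigner α β ((hX N).isHermitian ω)) x)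
        atTop (𝓝 ((semicircleLaw α β).real (Set.Iic x))) := by
  have hprob := isProbabilityMeasure_semicircleLaw α hβ
  refine ⟨hprob, ?_⟩
  let μ₀ : ProbabilityMeasure ℝ := ⟨semicircleLaw α β, hprob⟩
  have hatoms : NullSingletonClass (μ₀ : Measure ℝ) := nullSingletonClass_withDensity _
  have hroot : ∀ q : ℚ, q ≠ 0 → ∃ m : ℂ,
      (∀ᵐ ω ∂P, Tendsto (fun N => empiricalStieltjes (normalizedWigner (X N ω))
        ((((q : ℝ) : ℂ) * Complex.I - α) / β)) atTop (𝓝 m)) ∧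
      ∫ t : ℝ, ((t : ℂ) - ((q : ℝ) : ℂ) * Complex.I)⁻¹ ∂(semicircleLaw α β) = m / β := by
    intro q hq
    have hq' : (q : ℝ) ≠ 0 := by exact_mod_cast hq
    have hw : (((q : ℝ) : ℂ) * Complex.I).im ≠ 0 := by simpa using hq
    have hz : ((((q : ℝ) : ℂ) * Complex.I - α) / β).im ≠ 0 := by
      rw [Complex.div_ofReal_im]
      simpa using ⟨hq, hβ.ne'⟩
    obtain ⟨m, hm, hm1⟩ := exists_root_norm_lt_one hz
    exact ⟨m, ae_tendsto_empiricalStieltjes hX hz hm hm1,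
      integral_semicircleLaw_inv_sub α hβ hw hm hm1⟩
  choose m hm using hroot
  have hae : ∀ᵐ ω ∂P, ∀ (q : ℚ) (hq : q ≠ 0),
      Tendsto (fun N => empiricalStieltjes (normalizedWigner (X N ω))
        ((((q : ℝ) : ℂ) * Complex.I - α) / β)) atTop (𝓝 (m q hq)) :=
    ae_all_iff.mpr fun q => ae_all_iff.mpr fun hq => (hm q hq).1
  filter_upwards [hae] with ω hω x
  have hweak := tendsto_measureReal_Iic_of_tendsto_integral_resolvent
    (μ := fun N => ⟨empiricalMeasure
      (isHermitian_shiftScale_normalizedWigner α β ((hX N).isHermitian ω)), inferInstance⟩)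
    (μ₀ := μ₀) (fun q hq => by
      rw [show (μ₀ : Measure ℝ) = semicircleLaw α β from rfl, (hm q hq).2]
      refine ((hω q hq).div_const (β : ℂ)).congr' ?_
      filter_upwards [eventually_ne_atTop 0] with N hN
      exact (integral_inv_sub_empiricalMeasure_shiftScale α hβ hN ((hX N).isHermitian ω)
        (by simpa using hq)).symm) x
  refine hweak.congr' ?_
  filter_upwards [eventually_ne_atTop 0] with N hN
  exact measureReal_Iic_empiricalMeasure hN _ x
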